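/- Let $p\ge 1$ be real, and let $m_0$ (resp. $m_1$) be the least integer strictly greater than $p+\frac12$ (resp. $p-\frac12$). For a probability measure $\nu$ on $\mathbb R$ put $\nu^*(x)=\int e^{iux}\,\nu(du)$, and for an integrable function $f$ put $f^*(x)=\int e^{iux}f(u)\,du$. Let $W_p(\mu,\nu)=\inf_\pi\big(\int|x-y|^p\,\pi(dx,dy)\big)^{1/p}$, the infimum being over all probability measures $\pi$ on $\mathbb R^2$ with marginals $\mu$ and $\nu$. Let $k\ge 0$ be a symmetric function on $\mathbb R$ with $\int k=1$ whose Fourier transform $k^*$ is supported on $[-1,1]$ and is $\lceil p\rceil$ times differentiable with Lipschitz $\lceil p\rceil$-th derivative. Then there is a constant $C$, depending only on $p$ and $k$, such that the following holds. Let $n\ge1$, $0<h\le 1$ and $0\le\rho\le n^{-1/2}$, and let $\mu,\mu_\varepsilon$ be probability measures on $\mathbb R$ such that $\mu_\varepsilon^*$ does not vanish and $r_\varepsilon=1/\mu_\varepsilon^*$ is $m_0$ times continuously differentiable. Let $Y_i=X_i+\varepsilon_i$, $1\le i\le n$, where $X_1,\dots,X_n$ are i.i.d. with law $\mu$, $\varepsilon_1,\dots,\varepsilon_n$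 are i.i.d. with law $\mu_\varepsilon$, and $(X_1,\dots,X_n)$ is independent of $(\varepsilon_1,\dots,\varepsilon_n)$; let $Y$ denote a random variable with the common law of the $Y_i$. Put $$\tilde k_h(x)=\frac1{2\pi}\int\frac{e^{iux}k^*(u)}{\mu_\varepsilon^*(-u/h)}\,du,\qquad \hat F_n(t)=\frac1{nh}\int_{-\infty}^t\sum_{j=1}^n\tilde k_h\Big(\frac{u-Y_j}h\Big)du,$$ and let $\tilde\mu_n$ be a (random) probability measure whose distribution function $\tilde F_n$ satisfies, for every distribution function $G$ of a probability measure on $\mathbb R$, $$\int|x|^{p-1}|\hat F_n-\tilde F_n|(x)\,dx\le\int|x|^{p-1}|\hat F_n-G|(x)\,dx+\rho.$$ Then $$\mathbb E\,W_p^p(\tilde\mu_n,\mu)\le\frac1{\sqrt n}+h^p2^{p-1}\int|x|^pk(x)\,dx+\frac C{\sqrt n}(A_1+A_2+A_3+A_4),$$ where $$A_1=\Big(\sup_{t\in[-2,2]}\sum_{\ell=0}^{1}|r_\varepsilon^{(\ell)}(t)|\Big)\int_0^\infty|x|^{p-1}\sqrt{\mathbb P(|Y|\ge x)}\,dx,\qquad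 A_2=\sup_{t\in[-2,2]}\sum_{\ell=0}^{m_0}|r_\varepsilon^{(\ell)}(t)|,$$ $$A_3=\Big[\mathbb E|Y|^{2p-\frac12}\int_{-1/h}^{1/h}\frac{|r_\varepsilon(x)|^2}{|x|^2}\mathbf 1_{[-1,1]^c}(x)\,dx\Big]^{1/2},\qquad A_4=\Big[\sum_{\ell=0}^{m_1}\int_{-1/h}^{1/h}\frac{|r_\varepsilon^{(\ell)}(x)|^2}{|x|^2}\mathbf 1_{[-1,1]^c}(x)\,dx\Big]^{1/2}.$$ All quantities are in $[0,\infty]$, with $0\cdot\infty=0$; the inequality is trivial when the right-hand side is infinite. -/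

import Mathlib

open MeasureTheory ProbabilityTheory Set
open scoped ENNReal NNReal

namespace WassersteinDeconvolution

/-- The Wasserstein distance of order `p` between two measures on the real line: the infimum of
`(∫ |x - y|^p dπ)^(1/p)` over all couplings `π` of `μ` and `ν`, with values in `[0, ∞]`. -/
noncomputable def wasserstein (p : ℝ) (μ ν : Measure ℝ) : ℝ≥0∞ :=
  ⨅ π ∈ {π : Measure (ℝ × ℝ) | IsProbabilityMeasure π ∧ π.fst = μ ∧ π.snd = ν},
    (∫⁻ z, ENNReal.ofReal (|z.1 - z.2| ^ p) ∂π) ^ (1 / p)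

/-- The Fourier transform `f^*(x) = ∫ e^{iux} f(u) du`. -/
noncomputable def fourierStar (f : ℝ → ℝ) (x : ℝ) : ℂ :=
  ∫ u : ℝ, Complex.exp (Complex.I * u * x) * f u

/-- The least integer strictly greater than `x`, for `x ≥ 0`. -/
noncomputable def leastGt (x : ℝ) : ℕ := ⌊x⌋₊ + 1

/-- The kernels admitted in the construction: symmetric probability densities whose Fourier
transform is supported on `[-1, 1]` and is `⌈p⌉` times differentiable with Lipschitz `⌈p⌉`-th
derivative. -/
structure IsKernel (p : ℝ) (k : ℝ → ℝ) : Prop where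
  nonneg : ∀ x, 0 ≤ k x
  symm : ∀ x, k (-x) = k x
  integrable : Integrable k
  integral_eq_one : ∫ x, k x = 1
  contDiff : ContDiff ℝ (⌈p⌉₊ : ℕ) (fourierStar k)
  lipschitz : ∃ L : ℝ≥0, LipschitzWith L (iteratedDeriv ⌈p⌉₊ (fourierStar k))
  support : ∀ u, 1 < |u| → fourierStar k u = 0

/-- The function `r_ε = 1 / μ_ε^*`. -/
noncomputable def recipChar (με : Measure ℝ) (t : ℝ) : ℂ := 1 / charFun με t

/-- The deconvolution kernel `(2π)⁻¹ ∫ e^{iux} k^*(u) / μ_ε^*(-u/h) du`. The integral is a real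
number, so that taking the real part only changes the type. -/
noncomputable def deconvKernel (k : ℝ → ℝ) (με : Measure ℝ) (h x : ℝ) : ℝ :=
  (1 / (2 * (Real.pi : ℂ)) *
    ∫ u : ℝ, Complex.exp (Complex.I * u * x) * fourierStar k u / charFun με (-u / h)).re

/-- The preliminary estimator `F̂_n(t)` of the distribution function, from the data `y`. -/
noncomputable def prelimEstimator {n : ℕ} (k : ℝ → ℝ) (με : Measure ℝ) (h : ℝ) (y : Fin n → ℝ)
    (t : ℝ) : ℝ :=
  1 / (n * h) * ∫ u in Iic t, ∑ j, deconvKernel k με h ((u - y j) / h)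

/-- The weighted distance `∫ |x|^{p-1} |F - G|(x) dx`. -/
noncomputable def weightedDist (p : ℝ) (F G : ℝ → ℝ) : ℝ≥0∞ :=
  ∫⁻ x : ℝ, ENNReal.ofReal (|x| ^ (p - 1) * |F x - G x|)

/-- The distribution function of the probability measure `m` minimizes, up to `ρ`, the weighted
distance to `Fhat` among all distribution functions. -/
def IsIsotoneApprox (p ρ : ℝ) (Fhat : ℝ → ℝ) (m : ProbabilityMeasure ℝ) : Prop :=
  ∀ G : ProbabilityMeasure ℝ,
    weightedDist p Fhat (cdf (m : Measure ℝ)) ≤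
      weightedDist p Fhat (cdf (G : Measure ℝ)) + ENNReal.ofReal ρ

/-- `sup_{t ∈ [-2,2]} ∑_{ℓ=0}^{m} |r^{(ℓ)}(t)|`. -/
noncomputable def supDeriv (r : ℝ → ℂ) (m : ℕ) : ℝ≥0∞ :=
  ⨆ t ∈ Icc (-2 : ℝ) 2, ∑ l ∈ Finset.range (m + 1), ENNReal.ofReal ‖iteratedDeriv l r t‖

/-- `∫_{-1/h}^{1/h} |r^{(ℓ)}(x)|² / |x|² 1_{[-1,1]^c}(x) dx`. -/
noncomputable def outerIntegral (r : ℝ → ℂ) (h : ℝ) (l : ℕ) : ℝ≥0∞ :=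
  ∫⁻ x in Icc (-(1 / h)) (1 / h) ∩ (Icc (-1 : ℝ) 1)ᶜ,
    ENNReal.ofReal (‖iteratedDeriv l r x‖ ^ 2 / |x| ^ 2)

/-! In the four terms below, `r` stands for `r_ε` and `ν` for the law of an observation `Y`. -/

noncomputable def termA1 (p : ℝ) (r : ℝ → ℂ) (ν : Measure ℝ) : ℝ≥0∞ :=
  supDeriv r 1 *
    ∫⁻ x in Ioi (0 : ℝ), ENNReal.ofReal (|x| ^ (p - 1)) * ν {y | x ≤ |y|} ^ (1 / 2 : ℝ)

noncomputable def termA2 (p : ℝ) (r : ℝ → ℂ) : ℝ≥0∞ :=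
  supDeriv r (leastGt (p + 1 / 2))

noncomputable def termA3 (p : ℝ) (r : ℝ → ℂ) (ν : Measure ℝ) (h : ℝ) : ℝ≥0∞ :=
  ((∫⁻ y, ENNReal.ofReal (|y| ^ (2 * p - 1 / 2)) ∂ν) * outerIntegral r h 0) ^ (1 / 2 : ℝ)

noncomputable def termA4 (p : ℝ) (r : ℝ → ℂ) (h : ℝ) : ℝ≥0∞ :=
  (∑ l ∈ Finset.range (leastGt (p - 1 / 2) + 1), outerIntegral r h l) ^ (1 / 2 : ℝ)

end WassersteinDeconvolution

namespace WassersteinDeconvolution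

/-! ### Couplings on the real line -/

/-! Let `M` be the law of `X + hZ` with `Z` of density `k`. Coupling `X + hZ` with `X` costs `h^p ∫
|x|^p k`, and gluing this to a coupling of `μ̃_n` with `M` costs a factor `2^(p-1)`; this gives the
bias term. On the line the quantile coupling bounds the remaining cost by `p 2^(p-1) ∫ |x|^(p-1)
|F̃_n - F_M|`. The near-minimality of `F̃_n`, tested against `F_M` itself, bounds this weighted
distance by twice the one between `F̂_n` and `F_M`, plus `ρ`. As `r_ε(0) = 1`, the term `A₂` is at
least `1` and absorbs `ρ`.

It remains to bound `E ∫ |x|^(p-1) |F̂_n - F_M|`. Here `F̂_n(x)` is an empirical mean of `K(x -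
Y_j)`, where `K` is the primitive of the function whose Fourier symbol is `k^*(-hv) r_ε(v)`.
Multiplying by the characteristic function of `Y` cancels `μ_ε^*`, so `E K(x - Y) = F_M(x)`: the
estimator is unbiased for the smoothed law. For each `x` the deviation is at most `n^(-1/2)` times
the `L²` norm of `K(x - Y) - c`, for any constant `c`.

A smooth cutoff on `[-2, 2]` splits `K = K₁ + K₂`. The low frequency part `K₁` is the primitive of
an integrable density `a`, and is compared with its limits `0` and `∫ a` at the two ends of the
line. The error is a tail of `a`, or occurs when `|Y| ≥ |x|/2`; this leads to `∫ |u|^p |a|` (term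
`A₂`) and to `‖a‖₁` times the tail integral of `Y` (term `A₁`). In the high frequency part the
primitive is taken on the Fourier side, dividing the symbol by `-iv` away from the origin.
Cauchy–Schwarz against a polynomial weight and Plancherel then give `A₃` and `A₄`, whose weight
`|x|^(-2)` is this division.

The low part needs `m₀` derivatives in frequency, which can exceed `⌈p⌉` by one. The missing
derivative of `k^*` is replaced by its Lipschitz bound, through difference quotients and Fatou. -/

lemma lintegral_Ioc_rpow {p : ℝ} (hp : 1 ≤ p) {a b : ℝ} (ha : 0 ≤ a) (hab : a ≤ b) :
    ∫⁻ x in Ioc a b, ENNReal.ofReal (|x| ^ (p - 1)) = ENNReal.ofReal ((b ^ p - a ^ p) / p) := by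
  have h1 : ∫⁻ x in Ioc a b, ENNReal.ofReal (|x| ^ (p - 1))
      = ∫⁻ x in Ioc a b, ENNReal.ofReal (x ^ (p - 1)) := by
    refine setLIntegral_congr_fun measurableSet_Ioc fun x hx => ?_
    rw [abs_of_pos (ha.trans_lt hx.1)]
  have hi : IntervalIntegrable (fun x : ℝ => x ^ (p - 1)) volume a b :=
    intervalIntegral.intervalIntegrable_rpow' (by linarith)
  rw [h1, ← ofReal_integral_eq_lintegral_ofReal, ← intervalIntegral.integral_of_le hab,
    integral_rpow (Or.inl (by linarith))]
  · simp
  · exact (intervalIntegrable_iff_integrableOn_Ioc_of_le hab).1 hi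
  · filter_upwards [ae_restrict_mem measurableSet_Ioc] with x hx
    exact Real.rpow_nonneg (ha.trans hx.1.le) _

lemma lintegral_Ioc_neg_rpow (q a b : ℝ) :
    ∫⁻ x in Ioc a b, ENNReal.ofReal (|x| ^ q)
      = ∫⁻ x in Ioc (-b) (-a), ENNReal.ofReal (|x| ^ q) := by
  have h := (Measure.measurePreserving_neg (volume : Measure ℝ)).setLIntegral_comp_preimage
    (s := Ioc a b) measurableSet_Ioc (f := fun x => ENNReal.ofReal (|x| ^ q)) (by fun_prop)
  rw [← h]
  simp only [abs_neg]
  refine setLIntegral_congr ?_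
  simp only [neg_preimage, Set.neg_Ioc]
  exact Ico_ae_eq_Ioc

/-- The power cost is controlled by a weighted length of the interval between two points. -/
lemma rpow_abs_sub_le {p : ℝ} (hp : 1 ≤ p) {a b : ℝ} (hab : a ≤ b) :
    ENNReal.ofReal (|a - b| ^ p) ≤
      ENNReal.ofReal (p * 2 ^ (p - 1)) * ∫⁻ x in Ioc a b, ENNReal.ofReal (|x| ^ (p - 1)) := by
  have hp0 : 0 < p := by linarith
  have h2 : (1 : ℝ) ≤ 2 ^ (p - 1) := Real.one_le_rpow (by norm_num) (by linarith)
  -- On one side of the origin superadditivity of `t ↦ t^p` gives `(b - a)^p ≤ b^p - a^p`. The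
  -- factor `2^(p-1)` is needed only when the interval contains the origin.
  have key : ∀ a b : ℝ, 0 ≤ a → a ≤ b → ENNReal.ofReal ((b - a) ^ p) ≤
      ENNReal.ofReal (p * 2 ^ (p - 1)) * ∫⁻ x in Ioc a b, ENNReal.ofReal (|x| ^ (p - 1)) := by
    intro a b ha hab
    rw [lintegral_Ioc_rpow hp ha hab, ← ENNReal.ofReal_mul (by positivity)]
    apply ENNReal.ofReal_le_ofReal
    have h := Real.add_rpow_le_rpow_add (sub_nonneg.2 hab) ha hp
    rw [sub_add_cancel] at h
    have h3 : (0 : ℝ) ≤ (b - a) ^ p := Real.rpow_nonneg (sub_nonneg.2 hab) _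
    rw [show p * 2 ^ (p - 1) * ((b ^ p - a ^ p) / p) = 2 ^ (p - 1) * (b ^ p - a ^ p) by
      field_simp]
    nlinarith
  rw [abs_sub_comm, abs_of_nonneg (sub_nonneg.2 hab)]
  rcases le_total 0 a with ha | ha
  · exact key a b ha hab
  rcases le_total b 0 with hb | hb
  · have := key (-b) (-a) (by linarith) (by linarith)
    rw [lintegral_Ioc_neg_rpow]
    convert this using 3
    ring
  · rw [← Ioc_union_Ioc_eq_Ioc ha hb, lintegral_union measurableSet_Ioc
      (Ioc_disjoint_Ioc_of_le le_rfl), lintegral_Ioc_neg_rpow (p - 1) a 0, neg_zero,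
      lintegral_Ioc_rpow hp le_rfl (by linarith : 0 ≤ -a), lintegral_Ioc_rpow hp le_rfl hb,
      Real.zero_rpow hp0.ne']
    have h := ENNReal.rpow_add_le_mul_rpow_add_rpow (ENNReal.ofReal (-a)) (ENNReal.ofReal b) hp
    rw [← ENNReal.ofReal_add (by linarith) hb,
      ENNReal.ofReal_rpow_of_nonneg (by linarith) hp0.le,
      ENNReal.ofReal_rpow_of_nonneg (by linarith) hp0.le,
      ENNReal.ofReal_rpow_of_nonneg hb hp0.le] at h
    have e : (2 : ℝ≥0∞) ^ (p - 1) = ENNReal.ofReal (2 ^ (p - 1)) := by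
      rw [← ENNReal.ofReal_rpow_of_nonneg (by norm_num) (by linarith)]; simp
    have ha' : 0 ≤ (-a) ^ p := Real.rpow_nonneg (by linarith) _
    have hb' : 0 ≤ b ^ p := Real.rpow_nonneg hb _
    calc ENNReal.ofReal ((b - a) ^ p) = ENNReal.ofReal ((-a + b) ^ p) := by ring_nf
      _ ≤ _ := h
      _ = _ := by
        rw [e, ← ENNReal.ofReal_add ha' hb', ← ENNReal.ofReal_add (by positivity) (by positivity),
          ← ENNReal.ofReal_mul (by positivity), ← ENNReal.ofReal_mul (by positivity)]
        congr 1
        field_simp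
        ring

/-- The quantile function of a measure on the line. -/
noncomputable def quantile (μ : Measure ℝ) (u : ℝ) : ℝ := sInf {x | u ≤ cdf μ x}

/-- Right continuity puts the infimum into the set, and `0 < u < 1` makes the set nonempty and
bounded below. This Galois connection is the only property of quantiles used afterwards. -/
lemma quantile_le_iff (μ : Measure ℝ) {u : ℝ} (hu : u ∈ Ioo (0 : ℝ) 1) (x : ℝ) :
    quantile μ u ≤ x ↔ u ≤ cdf μ x := by
  have hne : {x | u ≤ cdf μ x}.Nonempty :=
    (((tendsto_cdf_atTop μ).eventually (lt_mem_nhds hu.2)).exists).imp fun _ h => le_of_lt h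
  have hbdd : BddBelow {x | u ≤ cdf μ x} := by
    obtain ⟨y, hy⟩ := ((tendsto_cdf_atBot μ).eventually (gt_mem_nhds hu.1)).exists
    refine ⟨y, fun z hz => ?_⟩
    by_contra hlt
    exact absurd ((hz.trans (monotone_cdf μ (not_le.1 hlt).le)).trans_lt hy) (lt_irrefl _)
  constructor
  · intro h
    have hgt : ∀ y, x < y → u ≤ cdf μ y := by
      intro y hy
      obtain ⟨z, hz, hzy⟩ := exists_lt_of_csInf_lt hne (h.trans_lt hy)
      exact le_trans hz (monotone_cdf μ hzy.le)
    have hc : Filter.Tendsto (cdf μ) (nhdsWithin x (Ioi x)) (nhds (cdf μ x)) :=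
      ((cdf μ).right_continuous x).tendsto.mono_left (nhdsWithin_mono _ Ioi_subset_Ici_self)
    exact ge_of_tendsto hc (Filter.eventually_of_mem self_mem_nhdsWithin hgt)
  · intro h
    exact csInf_le hbdd h

lemma aemeasurable_quantile (μ : Measure ℝ) :
    AEMeasurable (quantile μ) (volume.restrict (Ioo (0 : ℝ) 1)) := by
  refine aemeasurable_restrict_of_monotoneOn measurableSet_Ioo fun u hu v hv huv => ?_
  rw [quantile_le_iff μ hu]
  exact huv.trans ((quantile_le_iff μ hv _).1 le_rfl)

lemma map_quantile (μ : Measure ℝ) [IsProbabilityMeasure μ] :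
    (volume.restrict (Ioo (0 : ℝ) 1)).map (quantile μ) = μ := by
  have : IsFiniteMeasure (volume.restrict (Ioo (0 : ℝ) 1)) := ⟨by simp⟩
  refine Measure.ext_of_Iic _ _ fun x => ?_
  rw [Measure.map_apply_of_aemeasurable (aemeasurable_quantile μ) measurableSet_Iic]
  rw [Measure.restrict_apply' measurableSet_Ioo]
  have h : quantile μ ⁻¹' Iic x ∩ Ioo 0 1 = Iic (cdf μ x) ∩ Ioo 0 1 := by
    ext u
    simp only [mem_inter_iff, mem_preimage, mem_Iic, and_congr_left_iff]
    exact fun hu => quantile_le_iff μ hu x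
  have h2 : (Iic (cdf μ x) ∩ Ioo 0 1 : Set ℝ) =ᵐ[volume] (Ioc 0 (cdf μ x) : Set ℝ) := by
    have e : (Ioo (0 : ℝ) 1 : Set ℝ) =ᵐ[volume] Ioc 0 1 := Ioo_ae_eq_Ioc
    have e2 : Iic (cdf μ x) ∩ Ioc 0 1 = Ioc 0 (cdf μ x) := by
      rw [inter_comm, Ioc_inter_Iic, min_eq_right (cdf_le_one μ x)]
    rw [← e2]
    exact (Filter.EventuallyEq.refl _ _).inter e
  rw [h, measure_congr h2, Real.volume_Ioc, sub_zero, ofReal_cdf]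

/-- The interval between the two points is written as the set where exactly one of two inequalities
holds. This removes the assumption on their order, and for quantiles each inequality turns into a
condition `u ≤ cdf x`, ready for Tonelli. -/
lemma rpow_cost_le_lintegral_indicator {p : ℝ} (hp : 1 ≤ p) (a b : ℝ) :
    ENNReal.ofReal (|a - b| ^ p) ≤ ENNReal.ofReal (p * 2 ^ (p - 1)) *
      ∫⁻ x, {x | ¬ (a ≤ x ↔ b ≤ x)}.indicator (fun x => ENNReal.ofReal (|x| ^ (p - 1))) x := by
  wlog hab : a ≤ b generalizing a b
  · have := this b a (not_le.1 hab).le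
    rw [abs_sub_comm]
    simpa only [iff_comm] using this
  have hs : {x : ℝ | ¬ (a ≤ x ↔ b ≤ x)} = Ico a b := by
    ext x
    simp only [mem_ofPred_eq, mem_Ico]
    constructor
    · intro h
      by_cases h1 : a ≤ x
      · exact ⟨h1, not_le.1 fun h2 => h (iff_of_true h1 h2)⟩
      · exact absurd (iff_of_false h1 fun h2 => h1 (hab.trans h2)) h
    · rintro ⟨h1, h2⟩ h
      exact absurd (h.1 h1) (not_le.2 h2)
  rw [hs, lintegral_indicator measurableSet_Ico, restrict_Ico_eq_restrict_Ioc]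
  exact rpow_abs_sub_le hp hab

/-- The quantile coupling has cost at most a weighted `L¹` distance of distribution functions. -/
lemma exists_coupling_cost_le {p : ℝ} (hp : 1 ≤ p) (μ ν : Measure ℝ) [IsProbabilityMeasure μ]
    [IsProbabilityMeasure ν] :
    ∃ π : Measure (ℝ × ℝ), IsProbabilityMeasure π ∧ π.fst = μ ∧ π.snd = ν ∧
      ∫⁻ z, ENNReal.ofReal (|z.1 - z.2| ^ p) ∂π ≤
        ENNReal.ofReal (p * 2 ^ (p - 1)) * weightedDist p (cdf μ) (cdf ν) := by
  set U : Measure ℝ := volume.restrict (Ioo (0 : ℝ) 1) with hU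
  have hUp : IsProbabilityMeasure U := ⟨by simp [hU]⟩
  have hm := (aemeasurable_quantile μ).prodMk (aemeasurable_quantile ν)
  refine ⟨U.map fun u => (quantile μ u, quantile ν u), Measure.isProbabilityMeasure_map hm,
    ?_, ?_, ?_⟩
  · rw [Measure.fst_map_prodMk₀ (aemeasurable_quantile ν), map_quantile]
  · rw [Measure.snd_map_prodMk₀ (aemeasurable_quantile μ), map_quantile]
  rw [lintegral_map' (by fun_prop) hm]
  have hmeas : MeasurableSet {z : ℝ × ℝ | ¬ (z.1 ≤ cdf μ z.2 ↔ z.1 ≤ cdf ν z.2)} := by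
    have h1 : MeasurableSet {z : ℝ × ℝ | z.1 ≤ cdf μ z.2} :=
      measurableSet_le measurable_fst ((monotone_cdf μ).measurable.comp measurable_snd)
    have h2 : MeasurableSet {z : ℝ × ℝ | z.1 ≤ cdf ν z.2} :=
      measurableSet_le measurable_fst ((monotone_cdf ν).measurable.comp measurable_snd)
    exact (MeasurableSet.iff h1 h2).compl
  have hmI : Measurable (fun z : ℝ × ℝ =>
      {z : ℝ × ℝ | ¬ (z.1 ≤ cdf μ z.2 ↔ z.1 ≤ cdf ν z.2)}.indicator
        (fun z => ENNReal.ofReal (|z.2| ^ (p - 1))) z) :=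
    Measurable.indicator (by fun_prop) hmeas
  calc ∫⁻ u, ENNReal.ofReal (|quantile μ u - quantile ν u| ^ p) ∂U
      ≤ ∫⁻ u, (ENNReal.ofReal (p * 2 ^ (p - 1)) * ∫⁻ x,
        {z : ℝ × ℝ | ¬ (z.1 ≤ cdf μ z.2 ↔ z.1 ≤ cdf ν z.2)}.indicator
        (fun z => ENNReal.ofReal (|z.2| ^ (p - 1))) (u, x)) ∂U := by
        refine lintegral_mono_ae ?_
        filter_upwards [ae_restrict_mem measurableSet_Ioo] with u hu
        refine (rpow_cost_le_lintegral_indicator hp _ _).trans (le_of_eq ?_)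
        congr 2
        ext x
        simp only [indicator, mem_ofPred_eq, quantile_le_iff _ hu]
    _ = ENNReal.ofReal (p * 2 ^ (p - 1)) * ∫⁻ x, ∫⁻ u,
        {z : ℝ × ℝ | ¬ (z.1 ≤ cdf μ z.2 ↔ z.1 ≤ cdf ν z.2)}.indicator
        (fun z => ENNReal.ofReal (|z.2| ^ (p - 1))) (u, x) ∂U := by
        rw [lintegral_const_mul', lintegral_lintegral_swap hmI.aemeasurable]
        exact ENNReal.ofReal_ne_top
    _ ≤ _ := by
        unfold weightedDist
        gcongr with x
        -- For fixed `x` the levels `u` that separate the two conditions form the interval between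
        -- the two values of the distribution functions, whose length is their distance.
        have e : ∀ u, {z : ℝ × ℝ | ¬ (z.1 ≤ cdf μ z.2 ↔ z.1 ≤ cdf ν z.2)}.indicator
            (fun z => ENNReal.ofReal (|z.2| ^ (p - 1))) (u, x)
            = (uIoc (cdf μ x) (cdf ν x)).indicator
              (fun _ => ENNReal.ofReal (|x| ^ (p - 1))) u := by
          intro u
          simp only [indicator, mem_ofPred_eq, mem_uIoc]
          congr 1
          simp only [eq_iff_iff, ← not_le]
          tauto
        simp_rw [e]
        rw [lintegral_indicator measurableSet_uIoc, setLIntegral_const,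
          ENNReal.ofReal_mul (by positivity)]
        gcongr
        refine (Measure.restrict_apply_le _ _).trans ?_
        rw [Real.volume_uIoc, abs_sub_comm]

/-- Gluing of two couplings along their common marginal. -/
lemma exists_gluing (π₁ π₂ : Measure (ℝ × ℝ)) [IsProbabilityMeasure π₁] [IsProbabilityMeasure π₂]
    (h : π₁.snd = π₂.fst) :
    ∃ γ : Measure ((ℝ × ℝ) × ℝ), IsProbabilityMeasure γ ∧ γ.map Prod.fst = π₁ ∧
      γ.map (fun z => (z.1.2, z.2)) = π₂ := by
  set κ := π₂.condKernel
  -- Draw a pair from `π₁`, then the third coordinate from the conditional law of `π₂` given the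
  -- shared second coordinate.
  refine ⟨π₁ ⊗ₘ (κ.comap Prod.snd measurable_snd), inferInstance, ?_, ?_⟩
  · exact Measure.fst_compProd _ _
  · refine Measure.ext_of_lintegral _ fun f hf => ?_
    rw [lintegral_map hf (by fun_prop), Measure.lintegral_compProd (by fun_prop)]
    simp only [Kernel.comap_apply]
    have hd := Measure.disintegrate π₂ κ
    conv_rhs => rw [← hd, Measure.lintegral_compProd hf, ← h, Measure.snd]
    rw [lintegral_map (hf.lintegral_kernel_prod_right') measurable_snd]

lemma wasserstein_rpow_le_cost {p : ℝ} (hp : 1 ≤ p) {μ ν : Measure ℝ} (π : Measure (ℝ × ℝ))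
    (h : IsProbabilityMeasure π) (h1 : π.fst = μ) (h2 : π.snd = ν) :
    wasserstein p μ ν ^ p ≤ ∫⁻ z, ENNReal.ofReal (|z.1 - z.2| ^ p) ∂π := by
  have hle : wasserstein p μ ν ≤ (∫⁻ z, ENNReal.ofReal (|z.1 - z.2| ^ p) ∂π) ^ (1 / p) :=
    iInf₂_le π ⟨h, h1, h2⟩
  have hp0 : 0 < p := by linarith
  calc wasserstein p μ ν ^ p ≤ ((∫⁻ z, ENNReal.ofReal (|z.1 - z.2| ^ p) ∂π) ^ (1 / p)) ^ p := by
        gcongr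
    _ = _ := by rw [← ENNReal.rpow_mul, one_div_mul_cancel hp0.ne', ENNReal.rpow_one]

/-- Glue the couplings and use convexity of `t ↦ t^p`. Stating the bound for arbitrary couplings
avoids any appeal to optimal ones. -/
lemma wasserstein_rpow_le_add {p : ℝ} (hp : 1 ≤ p) (π₁ π₂ : Measure (ℝ × ℝ))
    [IsProbabilityMeasure π₁] [IsProbabilityMeasure π₂] (h : π₁.snd = π₂.fst) :
    wasserstein p π₁.fst π₂.snd ^ p ≤ ENNReal.ofReal (2 ^ (p - 1)) *
      (∫⁻ z, ENNReal.ofReal (|z.1 - z.2| ^ p) ∂π₁ + ∫⁻ z, ENNReal.ofReal (|z.1 - z.2| ^ p) ∂π₂) := by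
  have hp0 : 0 < p := by linarith
  obtain ⟨γ, hγ, h1, h2⟩ := exists_gluing π₁ π₂ h
  have hm : Measurable fun z : (ℝ × ℝ) × ℝ => (z.1.1, z.2) := by fun_prop
  refine (wasserstein_rpow_le_cost hp (γ.map fun z => (z.1.1, z.2))
    (Measure.isProbabilityMeasure_map hm.aemeasurable) ?_ ?_).trans ?_
  · rw [Measure.fst_map_prodMk (by fun_prop), ← h1, Measure.fst,
      Measure.map_map (by fun_prop) (by fun_prop)]
    rfl
  · rw [Measure.snd_map_prodMk (by fun_prop), ← h2, Measure.snd,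
      Measure.map_map (by fun_prop) (by fun_prop)]
    rfl
  conv_rhs => rw [← h1, ← h2]
  rw [lintegral_map (by fun_prop) hm, lintegral_map (by fun_prop) (by fun_prop),
    lintegral_map (by fun_prop) (by fun_prop), ← lintegral_add_left (by fun_prop),
    ← lintegral_const_mul' _ _ ENNReal.ofReal_ne_top]
  refine lintegral_mono fun z => ?_
  have e : (2 : ℝ≥0∞) ^ (p - 1) = ENNReal.ofReal (2 ^ (p - 1)) := by
    rw [← ENNReal.ofReal_rpow_of_nonneg (by norm_num) (by linarith)]; simp
  rw [← e, ← ENNReal.ofReal_rpow_of_nonneg (abs_nonneg _) hp0.le,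
    ← ENNReal.ofReal_rpow_of_nonneg (abs_nonneg _) hp0.le,
    ← ENNReal.ofReal_rpow_of_nonneg (abs_nonneg _) hp0.le]
  refine le_trans ?_ (ENNReal.rpow_add_le_mul_rpow_add_rpow _ _ hp)
  gcongr
  rw [← ENNReal.ofReal_add (abs_nonneg _) (abs_nonneg _)]
  exact ENNReal.ofReal_le_ofReal (abs_sub_le _ _ _)

/-- Comparison of a measure with the convolution of another one, via distribution functions. -/
lemma wasserstein_rpow_le_weightedDist_conv {p : ℝ} (hp : 1 ≤ p) (m μ ζ : Measure ℝ)
    [IsProbabilityMeasure m] [IsProbabilityMeasure μ] [IsProbabilityMeasure ζ] :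
    wasserstein p m μ ^ p ≤ ENNReal.ofReal (2 ^ (p - 1)) *
      (ENNReal.ofReal (p * 2 ^ (p - 1)) * weightedDist p (cdf m) (cdf (Measure.conv μ ζ))
        + ∫⁻ z, ENNReal.ofReal (|z| ^ p) ∂ζ) := by
  obtain ⟨π₁, i₁, hf, hs, hc⟩ := exists_coupling_cost_le hp m (Measure.conv μ ζ)
  -- With independent `X ∼ μ` and `Z ∼ ζ`, the pair `(X + Z, X)` couples the convolution with `μ` at
  -- cost `E |Z|^p`.
  have hm : Measurable fun z : ℝ × ℝ => (z.1 + z.2, z.1) := by fun_prop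
  set π₂ := (μ.prod ζ).map fun z => (z.1 + z.2, z.1) with hπ₂
  have i₂ : IsProbabilityMeasure π₂ := Measure.isProbabilityMeasure_map hm.aemeasurable
  have e1 : π₂.fst = Measure.conv μ ζ := by
    rw [hπ₂, Measure.fst_map_prodMk (by fun_prop)]; rfl
  have e2 : π₂.snd = μ := by
    rw [hπ₂, Measure.snd_map_prodMk (by fun_prop)]
    exact Measure.fst_prod
  have h := wasserstein_rpow_le_add hp π₁ π₂ (hs.trans e1.symm)
  rw [hf, e2] at h
  refine h.trans ?_
  gcongr
  rw [hπ₂, lintegral_map (by fun_prop) hm, lintegral_prod _ (by fun_prop)]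
  simp

/-! ### The Fourier transform of compactly supported functions -/

open scoped FourierTransform SchwartzMap in
/-- Plancherel's theorem for integrable and square integrable functions. -/
lemma lintegral_enorm_sq_fourier {g : ℝ → ℂ} (hg : Integrable g) (hg2 : MemLp g 2) :
    ∫⁻ x, ‖𝓕 g x‖ₑ ^ 2 = ∫⁻ x, ‖g x‖ₑ ^ 2 := by
  set f : Lp ℂ 2 (volume : Measure ℝ) := hg2.toLp g with hf
  set G : Lp ℂ 2 (volume : Measure ℝ) := 𝓕 f with hG
  have hcont : Continuous (𝓕 g) :=
    VectorFourier.fourierIntegral_continuous Real.continuous_fourierChar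
      (by exact continuous_inner) hg
  -- The `L²` transform is known only through its tempered distribution. Testing against smooth
  -- compactly supported functions, and moving the transform onto the test function on both sides,
  -- identifies it with the integral.
  have hae : ∀ᵐ x, 𝓕 g x = G x := by
    refine ae_eq_of_integral_contDiff_smul_eq hcont.locallyIntegrable
      ((Lp.memLp G).locallyIntegrable (by norm_num)) fun φ hφ hφc => ?_
    have hφ' : ContDiff ℝ (⊤ : ℕ∞) (fun x => (φ x : ℂ)) := Complex.ofRealCLM.contDiff.comp hφ
    have hφc' : HasCompactSupport (fun x => (φ x : ℂ)) :=
      hφc.comp_left (g := fun x : ℝ => (x : ℂ)) (by simp)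
    set ψ : 𝓢(ℝ, ℂ) := hφc'.toSchwartzMap hφ' with hψ
    have h1 := congrArg (fun T : 𝓢'(ℝ, ℂ) => T ψ) (Lp.fourier_toTemperedDistribution_eq f)
    simp only [TemperedDistribution.fourier_apply, Lp.toTemperedDistribution_apply] at h1
    have h2 : ∫ x, (𝓕 ψ) x • f x = ∫ x, (𝓕 ψ) x • g x := by
      refine integral_congr_ae ?_
      filter_upwards [hg2.coeFn_toLp] with x hx
      rw [hx]
    have h3 : ∫ x, (𝓕 (ψ : ℝ → ℂ)) x • g x = ∫ x, ψ x • (𝓕 g) x := by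
      have := VectorFourier.integral_fourierIntegral_smul_eq_flip Real.continuous_fourierChar
        (L := innerₗ ℝ) (by exact continuous_inner) (ψ.integrable (μ := volume)) hg
      rwa [flip_innerₗ] at this
    have h4 : ∀ x, ψ x = (φ x : ℂ) := fun x => rfl
    rw [h2] at h1
    have h5 := h3.symm.trans h1
    simp only [h4] at h5
    simpa using h5
  have h6 : eLpNorm (𝓕 g) 2 volume = eLpNorm g 2 volume := by
    rw [eLpNorm_congr_ae hae, ← eLpNorm_congr_ae hg2.coeFn_toLp, ← Lp.enorm_def, ← Lp.enorm_def,
      ← ofReal_norm, ← ofReal_norm, hG, Lp.norm_fourier_eq]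
  have h7 := congrArg (fun t => t ^ 2) h6
  simp only [eLpNorm_eq_lintegral_rpow_enorm_toReal (p := 2) (by norm_num) (by norm_num)] at h7
  simp only [ENNReal.toReal_ofNat] at h7
  rw [← ENNReal.rpow_natCast, ← ENNReal.rpow_natCast, ← ENNReal.rpow_mul, ← ENNReal.rpow_mul] at h7
  norm_num at h7
  exact h7

open scoped FourierTransform in
/-- The Fourier transform `x ↦ ∫ e^{-ivx} g(v) dv`. -/
noncomputable def ft (g : ℝ → ℂ) (x : ℝ) : ℂ := 𝓕 g (x / (2 * Real.pi))

lemma ft_eq_integral (g : ℝ → ℂ) (x : ℝ) :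
    ft g x = ∫ v : ℝ, Complex.exp (-(Complex.I * v * x)) * g v := by
  rw [ft, Real.fourier_real_eq_integral_exp_smul]
  congr with v
  rw [smul_eq_mul]
  congr 2
  push_cast
  have : (Real.pi : ℂ) ≠ 0 := by exact_mod_cast Real.pi_ne_zero
  field_simp

lemma continuous_ft {g : ℝ → ℂ} (hg : Integrable g) : Continuous (ft g) :=
  (VectorFourier.fourierIntegral_continuous Real.continuous_fourierChar
      (by exact continuous_inner) hg).comp (by fun_prop)

lemma lintegral_comp_div (f : ℝ → ℝ≥0∞) {c : ℝ} (hc : 0 < c) :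
    ∫⁻ x, f (x / c) = ENNReal.ofReal c * ∫⁻ x, f x := by
  have hc' : c⁻¹ ≠ 0 := inv_ne_zero hc.ne'
  have h := (Homeomorph.mulRight₀ c⁻¹ hc').measurableEmbedding.lintegral_map (μ := volume) f
  simp only [Homeomorph.coe_mulRight₀] at h
  rw [Real.map_volume_mul_right hc', lintegral_smul_measure, inv_inv, abs_of_pos hc,
    smul_eq_mul] at h
  simpa [div_eq_mul_inv] using h.symm

lemma lintegral_enorm_sq_ft {g : ℝ → ℂ} (hg : Continuous g) (hc : HasCompactSupport g) :
    ∫⁻ x, ‖ft g x‖ₑ ^ 2 = ENNReal.ofReal (2 * Real.pi) * ∫⁻ x, ‖g x‖ₑ ^ 2 := by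
  rw [← lintegral_enorm_sq_fourier (hg.integrable_of_hasCompactSupport hc)
    (hg.memLp_of_hasCompactSupport hc)]
  exact lintegral_comp_div (fun x => ‖FourierTransform.fourier g x‖ₑ ^ 2) (by positivity)

lemma hasCompactSupport_iteratedDeriv {g : ℝ → ℂ} (hc : HasCompactSupport g) (m : ℕ) :
    HasCompactSupport (iteratedDeriv m g) := by
  induction m with
  | zero => simpa [iteratedDeriv_zero] using hc
  | succ m ih => rw [iteratedDeriv_succ]; exact ih.deriv

lemma ft_iteratedDeriv {g : ℝ → ℂ} {m : ℕ} (hg : ContDiff ℝ m g) (hc : HasCompactSupport g)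
    (x : ℝ) : ft (iteratedDeriv m g) x = (Complex.I * x) ^ m * ft g x := by
  have h := Real.fourier_iteratedDeriv (N := (m : ℕ∞)) (n := m) (by exact_mod_cast hg)
    (fun j hj => (hg.continuous_iteratedDeriv j (by exact_mod_cast hj)).integrable_of_hasCompactSupport
      (hasCompactSupport_iteratedDeriv hc j)) le_rfl
  rw [ft, h, ft]
  simp only [smul_eq_mul]
  congr 2
  push_cast
  have : (Real.pi : ℂ) ≠ 0 := by exact_mod_cast Real.pi_ne_zero
  field_simp

lemma lintegral_pow_mul_enorm_sq_ft {g : ℝ → ℂ} {m : ℕ} (hg : ContDiff ℝ m g)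
    (hc : HasCompactSupport g) :
    ∫⁻ x, ENNReal.ofReal (|x| ^ (2 * m)) * ‖ft g x‖ₑ ^ 2 =
      ENNReal.ofReal (2 * Real.pi) * ∫⁻ x, ‖iteratedDeriv m g x‖ₑ ^ 2 := by
  rw [← lintegral_enorm_sq_ft (hg.continuous_iteratedDeriv m le_rfl)
    (hasCompactSupport_iteratedDeriv hc m)]
  refine lintegral_congr fun x => ?_
  rw [ft_iteratedDeriv hg hc, enorm_mul, mul_pow]
  congr 1
  rw [← ofReal_norm, norm_pow, norm_mul, Complex.norm_I, one_mul, Complex.norm_real,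
    Real.norm_eq_abs, ← ENNReal.ofReal_pow (by positivity), ← pow_mul, mul_comm m 2]

lemma ft_comp_add (g : ℝ → ℂ) (s x : ℝ) :
    ft (fun v => g (v + s)) x = Complex.exp (Complex.I * s * x) * ft g x := by
  rw [ft_eq_integral, ft_eq_integral, ← integral_const_mul,
    ← integral_add_right_eq_self (fun v : ℝ => Complex.exp (Complex.I * s * x) *
      (Complex.exp (-(Complex.I * v * x)) * g v)) s]
  congr with v
  rw [← mul_assoc, ← Complex.exp_add]
  congr 2
  push_cast
  ring

lemma ft_sub {f g : ℝ → ℂ} (hf : Integrable f) (hg : Integrable g) (x : ℝ) :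
    ft (fun v => f v - g v) x = ft f x - ft g x := by
  have key : ∀ f : ℝ → ℂ, Integrable f →
      Integrable fun v : ℝ => Complex.exp (-(Complex.I * v * x)) * f v := by
    intro f hf
    refine hf.bdd_mul (c := 1) (by fun_prop) (Filter.Eventually.of_forall fun v => ?_)
    rw [Complex.norm_exp]; simp
  simp only [ft_eq_integral, mul_sub]
  exact integral_sub (key f hf) (key g hg)

lemma ft_const_mul (c : ℂ) (g : ℝ → ℂ) (x : ℝ) :
    ft (fun v => c * g v) x = c * ft g x := by
  simp only [ft_eq_integral, ← integral_const_mul]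
  congr with v
  ring

/-- A first order Sobolev bound for Lipschitz functions, through difference quotients. -/
lemma lintegral_sq_mul_enorm_sq_ft_le_of_lipschitz {g : ℝ → ℂ} {B : ℝ≥0} (hg : LipschitzWith B g)
    (hs : ∀ v, 2 < |v| → g v = 0) :
    ∫⁻ x, ENNReal.ofReal (|x| ^ 2) * ‖ft g x‖ₑ ^ 2 ≤
      ENNReal.ofReal (2 * Real.pi) * (6 * (B : ℝ≥0∞) ^ 2) := by
  have hc : HasCompactSupport g := HasCompactSupport.of_support_subset_isCompact
    (isCompact_Icc (a := (-2 : ℝ)) (b := 2)) fun v hv => by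
      by_contra h
      exact hv (hs v (not_le.1 fun h2 => h (abs_le.1 h2)))
  have hgi : Integrable g := hg.continuous.integrable_of_hasCompactSupport hc
  let s : ℕ → ℝ := fun n => 1 / ((n : ℝ) + 1)
  have hs0 : ∀ n, 0 < s n := fun n => by positivity
  have hs1 : ∀ n, s n ≤ 1 := fun n => by
    simp only [s]
    rw [div_le_one (by positivity)]
    have : (0 : ℝ) ≤ n := by positivity
    linarith
  -- On the Fourier side a difference quotient multiplies by `(e^{isx} - 1)/s`, which tends to `ix`.
  -- The quotients are bounded by `B` and supported in `[-3, 3]`, of length `6`, so Plancherel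
  -- bounds them uniformly and Fatou passes to the limit.
  let q : ℕ → ℝ → ℂ := fun n v => ((s n)⁻¹ : ℂ) * (g (v + s n) - g v)
  have hqc : ∀ n, Continuous (q n) := fun n => by
    have := hg.continuous
    fun_prop
  have hqz : ∀ n v, v ∉ Icc (-3 : ℝ) 3 → q n v = 0 := by
    intro n v hv
    have h3 : 3 < |v| := not_le.1 fun h => hv (abs_le.1 h)
    have h4 : 2 < |v + s n| := by
      have := abs_sub_abs_le_abs_sub v (-(s n))
      rw [abs_neg, abs_of_pos (hs0 n), sub_neg_eq_add] at this
      linarith [hs1 n]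
    simp [q, hs v (by linarith), hs _ h4]
  have hqcs : ∀ n, HasCompactSupport (q n) := fun n =>
    HasCompactSupport.of_support_subset_isCompact (isCompact_Icc (a := (-3 : ℝ)) (b := 3))
      fun v hv => by_contra fun h => hv (hqz n v h)
  have hqb : ∀ n v, ‖q n v‖ₑ ≤ B := by
    intro n v
    have h := hg.dist_le_mul (v + s n) v
    rw [dist_eq_norm, dist_eq_norm, add_sub_cancel_left, Real.norm_eq_abs,
      abs_of_pos (hs0 n)] at h
    have : ‖q n v‖ ≤ B := by
      simp only [q, norm_mul, norm_inv, Complex.norm_real, Real.norm_eq_abs, abs_of_pos (hs0 n)]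
      rw [inv_mul_le_iff₀ (hs0 n)]
      linarith
    rw [← ofReal_norm]
    exact ENNReal.ofReal_le_of_le_toReal (by simpa using this)
  have hqft : ∀ n x, ft (q n) x =
      ((s n)⁻¹ : ℂ) * ((Complex.exp (Complex.I * s n * x) - 1) * ft g x) := by
    intro n x
    simp only [q]
    rw [ft_const_mul, ft_sub (hgi.comp_add_right (s n)) hgi, ft_comp_add]
    ring
  have hint : ∀ n, ∫⁻ x, ‖ft (q n) x‖ₑ ^ 2 ≤
      ENNReal.ofReal (2 * Real.pi) * (6 * (B : ℝ≥0∞) ^ 2) := by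
    intro n
    rw [lintegral_enorm_sq_ft (hqc n) (hqcs n)]
    gcongr
    calc ∫⁻ x, ‖q n x‖ₑ ^ 2 ≤ ∫⁻ x, (Icc (-3 : ℝ) 3).indicator (fun _ => (B : ℝ≥0∞) ^ 2) x := by
          refine lintegral_mono fun x => ?_
          by_cases hx : x ∈ Icc (-3 : ℝ) 3
          · rw [indicator_of_mem hx]
            gcongr
            exact hqb n x
          · rw [hqz n x hx]; simp
      _ = _ := by
          rw [lintegral_indicator measurableSet_Icc, setLIntegral_const, Real.volume_Icc, mul_comm]
          norm_num
  have hlim : ∀ x, Filter.Tendsto (fun n => ‖ft (q n) x‖ₑ ^ 2) Filter.atTop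
      (nhds (ENNReal.ofReal (|x| ^ 2) * ‖ft g x‖ₑ ^ 2)) := by
    intro x
    have hst : Filter.Tendsto s Filter.atTop (nhdsWithin 0 {0}ᶜ) :=
      tendsto_nhdsWithin_iff.2 ⟨tendsto_one_div_add_atTop_nhds_zero_nat,
        Filter.Eventually.of_forall fun n => (hs0 n).ne'⟩
    have hd : HasDerivAt (fun t : ℝ => Complex.exp (Complex.I * t * x)) (Complex.I * x) 0 := by
      have h1 : HasDerivAt (fun t : ℝ => Complex.I * t * x) (Complex.I * x) 0 := by
        have := ((Complex.ofRealCLM.hasDerivAt (x := (0 : ℝ))).const_mul Complex.I).mul_const (x : ℂ)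
        simpa using this
      simpa using h1.cexp
    have h2 := (hasDerivAt_iff_tendsto_slope_zero.1 hd).comp hst
    have h3 : Filter.Tendsto (fun n => ft (q n) x) Filter.atTop
        (nhds (Complex.I * x * ft g x)) := by
      refine (h2.mul_const (ft g x)).congr fun n => ?_
      rw [hqft]
      simp only [Function.comp_apply, zero_add, Complex.real_smul]
      simp [mul_assoc]
    have h4 := ((ENNReal.continuous_pow 2).comp continuous_enorm).tendsto (Complex.I * x * ft g x)
    have e : ENNReal.ofReal (|x| ^ 2) * ‖ft g x‖ₑ ^ 2 = ‖Complex.I * x * ft g x‖ₑ ^ 2 := ?_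
    · rw [e]
      exact h4.comp h3
    rw [enorm_mul, enorm_mul, mul_pow]
    congr 1
    rw [← ofReal_norm, ← ofReal_norm, Complex.norm_I, Complex.norm_real,
      Real.norm_eq_abs, ENNReal.ofReal_one, one_mul, ENNReal.ofReal_pow (abs_nonneg x)]
  calc ∫⁻ x, ENNReal.ofReal (|x| ^ 2) * ‖ft g x‖ₑ ^ 2
      = ∫⁻ x, Filter.liminf (fun n => ‖ft (q n) x‖ₑ ^ 2) Filter.atTop := by
        refine lintegral_congr fun x => (hlim x).liminf_eq.symm
    _ ≤ Filter.liminf (fun n => ∫⁻ x, ‖ft (q n) x‖ₑ ^ 2) Filter.atTop := by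
        refine lintegral_liminf_le fun n => ?_
        have := continuous_ft ((hqc n).integrable_of_hasCompactSupport (hqcs n))
        fun_prop
    _ ≤ _ := by
        refine (Filter.liminf_le_liminf (Filter.Eventually.of_forall hint)).trans ?_
        simp

lemma iteratedDeriv_eq_zero_of_eq_zero_outside {g : ℝ → ℂ} {a : ℝ} (hs : ∀ v, a < |v| → g v = 0)
    (m : ℕ) (v : ℝ) (hv : a < |v|) : iteratedDeriv m g v = 0 := by
  have he : g =ᶠ[nhds v] fun _ => 0 := by
    filter_upwards [(continuous_abs.tendsto v).eventually (lt_mem_nhds hv)] with u hu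
    exact hs u hu
  rw [he.iteratedDeriv_eq]
  simp

lemma hasCompactSupport_of_eq_zero_outside {g : ℝ → ℂ} {a : ℝ} (hs : ∀ v, a < |v| → g v = 0) :
    HasCompactSupport g :=
  HasCompactSupport.of_support_subset_isCompact (isCompact_Icc (a := -a) (b := a)) fun v hv => by
    by_contra h
    exact hv (hs v (not_le.1 fun h2 => h (abs_le.1 h2)))

/-- The first order Lipschitz bound is applied to the `m`-th derivative. This gains one power of
`|x|` beyond the available derivatives, which the low frequency part requires. -/
lemma lintegral_pow_succ_mul_enorm_sq_ft_le {g : ℝ → ℂ} {m : ℕ} {B : ℝ≥0} (hg : ContDiff ℝ m g)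
    (hL : LipschitzWith B (iteratedDeriv m g)) (hs : ∀ v, 2 < |v| → g v = 0) :
    ∫⁻ x, ENNReal.ofReal (|x| ^ (2 * (m + 1))) * ‖ft g x‖ₑ ^ 2 ≤
      ENNReal.ofReal (2 * Real.pi) * (6 * (B : ℝ≥0∞) ^ 2) := by
  refine le_trans (le_of_eq ?_) (lintegral_sq_mul_enorm_sq_ft_le_of_lipschitz hL
    (iteratedDeriv_eq_zero_of_eq_zero_outside hs m))
  refine lintegral_congr fun x => ?_
  rw [ft_iteratedDeriv hg (hasCompactSupport_of_eq_zero_outside hs), enorm_mul, mul_pow, ← mul_assoc]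
  congr 1
  rw [← ofReal_norm, norm_pow, norm_mul, Complex.norm_I, one_mul, Complex.norm_real,
    Real.norm_eq_abs, ← ENNReal.ofReal_pow (by positivity), ← ENNReal.ofReal_mul (by positivity)]
  congr 1
  ring

/-- Cauchy–Schwarz against a polynomial weight. -/
lemma exists_lintegral_rpow_mul_le {q s : ℝ} (hq : 0 ≤ q) (hs : 2 * q + 1 < s) :
    ∃ C : ℝ≥0, ∀ f : ℝ → ℝ≥0∞, Measurable f →
      ∫⁻ x, ENNReal.ofReal (|x| ^ q) * f x ≤
        C * (∫⁻ x, ENNReal.ofReal ((1 + |x|) ^ s) * f x ^ 2) ^ (1 / 2 : ℝ) := by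
  -- The hypothesis `2q + 1 < s` is exactly integrability of `(1 + |x|)^(2q - s)`, the other factor
  -- in Cauchy–Schwarz.
  have hfin : ∫⁻ x : ℝ, ENNReal.ofReal ((1 + ‖x‖) ^ (-(s - 2 * q))) < ∞ :=
    finite_integral_one_add_norm (by simp; linarith)
  set D := ∫⁻ x : ℝ, ENNReal.ofReal ((1 + ‖x‖) ^ (-(s - 2 * q))) with hD
  refine ⟨(D ^ (1 / 2 : ℝ)).toNNReal, fun f hf => ?_⟩
  rw [ENNReal.coe_toNNReal (ENNReal.rpow_ne_top_of_nonneg (by norm_num) hfin.ne)]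
  have h := ENNReal.lintegral_mul_le_Lp_mul_Lq volume Real.HolderConjugate.two_two
    (f := fun x : ℝ => ENNReal.ofReal ((1 + |x|) ^ (q - s / 2)))
    (g := fun x : ℝ => ENNReal.ofReal ((1 + |x|) ^ (s / 2)) * f x) (by fun_prop) (by fun_prop)
  refine le_trans (lintegral_mono fun x => ?_) (h.trans (le_of_eq ?_))
  · simp only [Pi.mul_apply]
    rw [← mul_assoc, ← ENNReal.ofReal_mul (by positivity), ← Real.rpow_add (by positivity)]
    gcongr
    rw [sub_add_cancel]
    gcongr
    linarith
  · congr 2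
    · refine lintegral_congr fun x => ?_
      rw [ENNReal.ofReal_rpow_of_nonneg (by positivity) (by norm_num),
        ← Real.rpow_mul (by positivity), Real.norm_eq_abs]
      congr 2
      ring
    · refine lintegral_congr fun x => ?_
      rw [ENNReal.mul_rpow_of_nonneg _ _ (by norm_num),
        ENNReal.ofReal_rpow_of_nonneg (by positivity) (by norm_num),
        ← Real.rpow_mul (by positivity)]
      norm_num

lemma ofReal_one_add_abs_rpow_le (m : ℕ) (x : ℝ) :
    ENNReal.ofReal ((1 + |x|) ^ (2 * m : ℝ)) ≤
      ENNReal.ofReal (2 ^ (2 * m)) * (1 + ENNReal.ofReal (|x| ^ (2 * m))) := by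
  rw [← ENNReal.ofReal_one, ← ENNReal.ofReal_add (by norm_num) (by positivity),
    ← ENNReal.ofReal_mul (by positivity)]
  apply ENNReal.ofReal_le_ofReal
  have e : (2 * m : ℝ) = ((2 * m : ℕ) : ℝ) := by push_cast; ring
  rw [e, Real.rpow_natCast]
  have h1 : 1 + |x| ≤ 2 * max 1 |x| := by
    linarith [le_max_left 1 |x|, le_max_right 1 |x|]
  calc (1 + |x|) ^ (2 * m) ≤ (2 * max 1 |x|) ^ (2 * m) := by gcongr
    _ = 2 ^ (2 * m) * (max 1 |x|) ^ (2 * m) := by rw [mul_pow]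
    _ ≤ _ := by
      gcongr
      rcases max_cases 1 |x| with h | h <;> rw [h.1]
      · rw [one_pow]; linarith [show 0 ≤ |x| ^ (2 * m) by positivity]
      · linarith

/-- Weighted `L¹` norms of a function are bounded by its weighted `L²` norms. -/
lemma exists_lintegral_rpow_mul_enorm_le {q : ℝ} {m : ℕ} (hq : 0 ≤ q) (hm : q + 1 / 2 < m) :
    ∃ C : ℝ≥0, ∀ f : ℝ → ℂ, Measurable f →
      ∫⁻ x, ENNReal.ofReal (|x| ^ q) * ‖f x‖ₑ ≤
        C * ((∫⁻ x, ‖f x‖ₑ ^ 2) + ∫⁻ x, ENNReal.ofReal (|x| ^ (2 * m)) * ‖f x‖ₑ ^ 2) ^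
          (1 / 2 : ℝ) := by
  obtain ⟨C, hC⟩ := exists_lintegral_rpow_mul_le (q := q) (s := 2 * m) hq (by linarith)
  refine ⟨C * 2 ^ m, fun f hf => (hC _ hf.enorm).trans ?_⟩
  push_cast
  rw [mul_assoc]
  gcongr
  have e : (2 : ℝ≥0∞) ^ m = (ENNReal.ofReal (2 ^ (2 * m))) ^ (1 / 2 : ℝ) := by
    rw [ENNReal.ofReal_rpow_of_nonneg (by positivity) (by norm_num), ← Real.sqrt_eq_rpow,
      pow_mul', Real.sqrt_sq (by positivity), ENNReal.ofReal_pow (by norm_num)]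
    simp
  rw [e, ← ENNReal.mul_rpow_of_nonneg _ _ (by norm_num), ← lintegral_add_left (by fun_prop),
    ← lintegral_const_mul' _ _ ENNReal.ofReal_ne_top]
  refine ENNReal.rpow_le_rpow (lintegral_mono fun x => ?_) (by norm_num)
  refine (mul_le_mul_left (ofReal_one_add_abs_rpow_le m x) _).trans (le_of_eq ?_)
  ring

/-- One derivative in `L²` controls `|x| ft g` in `L²`, and this together with `ft g` in `L²` gives
integrability in dimension one. -/
lemma integrable_ft {g : ℝ → ℂ} (hg : ContDiff ℝ 1 g) (hc : HasCompactSupport g) :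
    Integrable (ft g) := by
  have hcont := continuous_ft (hg.continuous.integrable_of_hasCompactSupport hc)
  refine ⟨hcont.aestronglyMeasurable, ?_⟩
  obtain ⟨C, hC⟩ := exists_lintegral_rpow_mul_enorm_le (q := 0) (m := 1) le_rfl (by norm_num)
  have h := hC _ hcont.measurable
  simp only [Real.rpow_zero, ENNReal.ofReal_one, one_mul] at h
  refine lt_of_le_of_lt h ?_
  have hfin : ∀ f : ℝ → ℂ, Continuous f → HasCompactSupport f → ∫⁻ x, ‖f x‖ₑ ^ 2 < ∞ := by
    intro f hf hfc
    have := (hf.memLp_of_hasCompactSupport (p := 2) (μ := volume) hfc).eLpNorm_lt_top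
    rw [eLpNorm_eq_lintegral_rpow_enorm_toReal (by norm_num) (by norm_num)] at this
    simpa using (ENNReal.rpow_lt_top_iff_of_pos (by norm_num)).1 this
  rw [lintegral_pow_mul_enorm_sq_ft (m := 1) (by exact_mod_cast hg) hc,
    lintegral_enorm_sq_ft hg.continuous hc]
  refine ENNReal.mul_lt_top ENNReal.coe_lt_top (ENNReal.rpow_lt_top_of_nonneg (by norm_num) ?_)
  refine (ENNReal.add_lt_top.2 ⟨ENNReal.mul_lt_top ENNReal.ofReal_lt_top
    (hfin _ hg.continuous hc), ENNReal.mul_lt_top ENNReal.ofReal_lt_top (hfin _ ?_ ?_)⟩).ne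
  · exact hg.continuous_iteratedDeriv 1 (by norm_num)
  · exact hasCompactSupport_iteratedDeriv hc 1

/-! ### Empirical means of the observations -/

/-- Independence of the two vectors makes their joint law a product of two product measures;
regrouping the coordinates gives the product of the laws of the pairs. -/
lemma iIndepFun_prodMk {ι Ω : Type*} [Fintype ι] [MeasurableSpace Ω] {P : Measure Ω}
    [IsProbabilityMeasure P] {X ε : ι → Ω → ℝ} (hX : ∀ i, AEMeasurable (X i) P)
    (hε : ∀ i, AEMeasurable (ε i) P) (iX : iIndepFun X P) (iε : iIndepFun ε P)
    (h : IndepFun (fun ω i => X i ω) (fun ω i => ε i ω) P) :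
    iIndepFun (fun i ω => (X i ω, ε i ω)) P := by
  have hXm : AEMeasurable (fun ω i => X i ω) P := aemeasurable_pi_lambda _ hX
  have hεm : AEMeasurable (fun ω i => ε i ω) P := aemeasurable_pi_lambda _ hε
  have pX : ∀ i, IsProbabilityMeasure (P.map (X i)) := fun i =>
    Measure.isProbabilityMeasure_map (hX i)
  have pε : ∀ i, IsProbabilityMeasure (P.map (ε i)) := fun i =>
    Measure.isProbabilityMeasure_map (hε i)
  rw [iIndepFun_iff_map_fun_eq_pi_map fun i => (hX i).prodMk (hε i)]
  have h1 : ∀ i, P.map (fun ω => (X i ω, ε i ω)) = (P.map (X i)).prod (P.map (ε i)) := by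
    intro i
    rw [← indepFun_iff_map_prod_eq_prod_map_map (hX i) (hε i)]
    exact h.comp (measurable_pi_apply i) (measurable_pi_apply i)
  have h2 := (indepFun_iff_map_prod_eq_prod_map_map hXm hεm).1 h
  rw [(iIndepFun_iff_map_fun_eq_pi_map hX).1 iX, (iIndepFun_iff_map_fun_eq_pi_map hε).1 iε] at h2
  have h3 := (measurePreserving_arrowProdEquivProdArrow ℝ ℝ ι (fun i => P.map (X i))
    (fun i => P.map (ε i))).symm.map_eq
  rw [← h2, AEMeasurable.map_map_of_aemeasurable
    (MeasurableEquiv.measurable _).aemeasurable (hXm.prodMk hεm)] at h3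
  simp_rw [h1]
  rw [← h3]
  rfl

lemma iIndepFun_add {ι Ω : Type*} [Fintype ι] [MeasurableSpace Ω] {P : Measure Ω}
    [IsProbabilityMeasure P] {X ε : ι → Ω → ℝ} (hX : ∀ i, AEMeasurable (X i) P)
    (hε : ∀ i, AEMeasurable (ε i) P) (iX : iIndepFun X P) (iε : iIndepFun ε P)
    (h : IndepFun (fun ω i => X i ω) (fun ω i => ε i ω) P) :
    iIndepFun (fun i ω => X i ω + ε i ω) P :=
  (iIndepFun_prodMk hX hε iX iε h).comp (fun _ z => z.1 + z.2) fun _ => by fun_prop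

lemma lintegral_enorm_le_rpow {Ω : Type*} [MeasurableSpace Ω] {P : Measure Ω}
    [IsProbabilityMeasure P] {f : Ω → ℝ≥0∞} (hf : AEMeasurable f P) :
    ∫⁻ ω, f ω ∂P ≤ (∫⁻ ω, f ω ^ 2 ∂P) ^ (1 / 2 : ℝ) := by
  have h := ENNReal.lintegral_mul_le_Lp_mul_Lq P Real.HolderConjugate.two_two hf
    (aemeasurable_const (b := (1 : ℝ≥0∞)))
  simpa using h

/-- The mean absolute deviation of an empirical mean. -/
lemma lintegral_abs_empirical_sub_le {Ω : Type*} [MeasurableSpace Ω] {P : Measure Ω}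
    [IsProbabilityMeasure P] {n : ℕ} (hn : 1 ≤ n) {ν : Measure ℝ} [IsProbabilityMeasure ν]
    {Y : Fin n → Ω → ℝ} (hY : ∀ i, HasLaw (Y i) ν P) (hi : iIndepFun Y P) {f : ℝ → ℝ}
    (hf : Measurable f) {b : ℝ} (hb : ∀ y, |f y| ≤ b) (c : ℝ) :
    ∫⁻ ω, ENNReal.ofReal |1 / (n : ℝ) * ∑ j, f (Y j ω) - ∫ y, f y ∂ν| ∂P ≤
      ENNReal.ofReal ((n : ℝ) ^ (-(1 / 2) : ℝ)) *
        (∫⁻ y, ENNReal.ofReal ((f y - c) ^ 2) ∂ν) ^ (1 / 2 : ℝ) := by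
  have hn0 : (0 : ℝ) < n := by exact_mod_cast hn
  set Z : Fin n → Ω → ℝ := fun j ω => f (Y j ω) with hZ
  have hZm : ∀ j, AEMeasurable (Z j) P := fun j => hf.comp_aemeasurable (hY j).aemeasurable
  have hZL : ∀ j, MemLp (Z j) 2 P := fun j =>
    MemLp.of_bound (hZm j).aestronglyMeasurable b (Filter.Eventually.of_forall fun ω => hb _)
  have hfL : MemLp f 2 ν :=
    MemLp.of_bound hf.aestronglyMeasurable b (Filter.Eventually.of_forall hb)
  have hmean : ∀ j, ∫ ω, Z j ω ∂P = ∫ y, f y ∂ν := by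
    intro j
    rw [← (hY j).map_eq, integral_map (hY j).aemeasurable hf.aestronglyMeasurable]
  have hvar : ∀ j, Var[Z j; P] = Var[f; ν] := by
    intro j
    rw [← (hY j).map_eq, variance_map hf.aemeasurable (hY j).aemeasurable]
    rfl
  have hindep : Pairwise fun i j => IndepFun (Z i) (Z j) P := fun i j hij =>
    (hi.indepFun hij).comp hf hf
  have hS : Var[∑ j, Z j; P] = n * Var[f; ν] := by
    rw [IndepFun.variance_sum (fun j _ => hZL j) (fun i _ j _ hij => hindep hij)]
    simp [hvar]
  have hSL : MemLp (∑ j, Z j) 2 P := memLp_finsetSum' _ fun j _ => hZL j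
  have hES : ∫ ω, (∑ j, Z j) ω ∂P = n * ∫ y, f y ∂ν := by
    simp only [Finset.sum_apply]
    rw [integral_finsetSum _ fun j _ => (hZL j).integrable (by norm_num)]
    simp [hmean]
  -- The variance is at most the second moment about any point. Keeping `c` free allows a centring
  -- adapted to `x` later.
  have hVc : Var[f; ν] ≤ ∫ y, (f y - c) ^ 2 ∂ν := by
    rw [← variance_sub_const hf.aestronglyMeasurable c]
    refine (variance_le_expectation_sq (hf.sub_const c).aestronglyMeasurable).trans (le_of_eq ?_)
    rfl
  have hint : Integrable (fun y => (f y - c) ^ 2) ν := (hfL.sub (memLp_const c)).integrable_sq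
  calc ∫⁻ ω, ENNReal.ofReal |1 / (n : ℝ) * ∑ j, f (Y j ω) - ∫ y, f y ∂ν| ∂P
      = ENNReal.ofReal (1 / n) * ∫⁻ ω, ‖(∑ j, Z j) ω - ∫ ω, (∑ j, Z j) ω ∂P‖ₑ ∂P := by
        rw [← lintegral_const_mul' _ _ ENNReal.ofReal_ne_top]
        refine lintegral_congr fun ω => ?_
        rw [← ofReal_norm, ← ENNReal.ofReal_mul (by positivity), hES, Real.norm_eq_abs]
        congr 1
        rw [← abs_of_pos (show (0 : ℝ) < 1 / n by positivity), ← abs_mul,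
          abs_of_pos (show (0 : ℝ) < 1 / n by positivity), mul_sub, ← mul_assoc,
          one_div_mul_cancel hn0.ne', one_mul, Finset.sum_apply]
    _ ≤ ENNReal.ofReal (1 / n) *
        (∫⁻ ω, ‖(∑ j, Z j) ω - ∫ ω, (∑ j, Z j) ω ∂P‖ₑ ^ 2 ∂P) ^ (1 / 2 : ℝ) := by
        gcongr
        exact lintegral_enorm_le_rpow
          ((hSL.aestronglyMeasurable.aemeasurable.sub_const _).enorm)
    _ = ENNReal.ofReal (1 / n) * (ENNReal.ofReal (n * Var[f; ν])) ^ (1 / 2 : ℝ) := by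
        rw [← hS, ofReal_variance hSL, evariance]
    _ = ENNReal.ofReal ((n : ℝ) ^ (-(1 / 2) : ℝ)) * (ENNReal.ofReal Var[f; ν]) ^ (1 / 2 : ℝ) := by
        rw [ENNReal.ofReal_mul hn0.le, ENNReal.mul_rpow_of_nonneg _ _ (by norm_num), ← mul_assoc,
          ENNReal.ofReal_rpow_of_nonneg hn0.le (by norm_num), ← ENNReal.ofReal_mul (by positivity)]
        congr 2
        rw [one_div, ← Real.rpow_neg_one, ← Real.rpow_add hn0]
        norm_num
    _ ≤ _ := by
        gcongr
        rw [← ofReal_integral_eq_lintegral_ofReal hint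
          (Filter.Eventually.of_forall fun y => sq_nonneg _)]
        exact ENNReal.ofReal_le_ofReal hVc

/-! ### Distribution functions of convolutions with signed densities -/

lemma charFun_withDensity_ofReal {a : ℝ → ℝ} (ham : AEMeasurable a) (t : ℝ) :
    charFun (volume.withDensity fun x => ENNReal.ofReal (a x)) t =
      ∫ x : ℝ, Complex.exp (t * x * Complex.I) * (max (a x) 0 : ℝ) := by
  rw [charFun_apply_real, integral_withDensity_eq_integral_toReal_smul₀ (by fun_prop)
    (Filter.Eventually.of_forall fun x => ENNReal.ofReal_lt_top)]
  congr with x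
  rw [ENNReal.toReal_ofReal', Complex.real_smul, mul_comm]

lemma conv_apply_Iic (ν α : Measure ℝ) [SFinite α] (t : ℝ) :
    (Measure.conv ν α) (Iic t) = ∫⁻ y, α (Iic (t - y)) ∂ν := by
  rw [← lintegral_indicator_one measurableSet_Iic,
    Measure.lintegral_conv (measurable_one.indicator measurableSet_Iic)]
  refine lintegral_congr fun y => ?_
  rw [← lintegral_indicator_one measurableSet_Iic]
  refine lintegral_congr fun x => ?_
  simp only [indicator, mem_Iic, le_sub_iff_add_le', Pi.one_apply]

/-- If the Fourier transform of a signed density times the characteristic function of `ν` is a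
characteristic function, then the convolution has the corresponding distribution function. -/
lemma integral_setIntegral_Iic_eq {a : ℝ → ℝ} (ha : Integrable a)
    (ν M : Measure ℝ) [IsProbabilityMeasure ν] [IsFiniteMeasure M]
    (h : ∀ t : ℝ, (∫ x : ℝ, Complex.exp (t * x * Complex.I) * (a x : ℂ)) * charFun ν t
      = charFun M t) (t : ℝ) :
    ∫ y, (∫ u in Iic (t - y), a u) ∂ν = M.real (Iic t) := by
  set α := volume.withDensity fun x => ENNReal.ofReal (a x) with hα
  set β := volume.withDensity fun x => ENNReal.ofReal (-a x) with hβ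
  have fα : IsFiniteMeasure α := isFiniteMeasure_withDensity_ofReal ha.2
  have fβ : IsFiniteMeasure β := isFiniteMeasure_withDensity_ofReal ha.neg.2
  have hexp : ∀ (t : ℝ) (b : ℝ → ℝ), Integrable b →
      Integrable fun x : ℝ => Complex.exp (t * x * Complex.I) * (b x : ℂ) := by
    intro t b hb
    refine hb.ofReal.bdd_mul (c := 1) (by fun_prop) (Filter.Eventually.of_forall fun x => ?_)
    rw [Complex.norm_exp]; simp
  -- The negative part is moved to the other side, so that the signed identity becomes an equality
  -- of finite measures, determined by their characteristic functions.
  have hchar : Measure.conv ν α = Measure.conv ν β + M := by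
    refine Measure.ext_of_charFun (funext fun t => ?_)
    have hadd : charFun (Measure.conv ν β + M) t = charFun (Measure.conv ν β) t + charFun M t := by
      simp only [charFun_apply_real]
      rw [integral_add_measure]
      all_goals
        refine Integrable.of_bound (by fun_prop) 1 (Filter.Eventually.of_forall fun x => ?_)
        rw [Complex.norm_exp]; simp
    rw [hadd, charFun_conv, charFun_conv, ← h t, hα, hβ, charFun_withDensity_ofReal ha.aemeasurable,
      charFun_withDensity_ofReal (a := fun x => -a x) ha.aemeasurable.neg]
    have e : ∫ x : ℝ, Complex.exp (t * x * Complex.I) * (a x : ℂ) =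
        (∫ x : ℝ, Complex.exp (t * x * Complex.I) * (max (a x) 0 : ℝ)) -
        ∫ x : ℝ, Complex.exp (t * x * Complex.I) * (max (-a x) 0 : ℝ) := by
      rw [← integral_sub (hexp t _ ha.pos_part) (hexp t _ ha.neg_part)]
      congr with x
      rw [← mul_sub]
      congr 1
      norm_cast
      rcases le_total (a x) 0 with h0 | h0
      · rw [max_eq_right h0, max_eq_left (by linarith)]; ring
      · rw [max_eq_left h0, max_eq_right (by linarith)]; ring
    rw [e]
    ring
  have hset : ∀ s, ∫ u in Iic s, a u = α.real (Iic s) - β.real (Iic s) := by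
    intro s
    rw [integral_eq_lintegral_pos_part_sub_lintegral_neg_part ha.integrableOn, measureReal_def,
      measureReal_def, hα, hβ, withDensity_apply _ measurableSet_Iic,
      withDensity_apply _ measurableSet_Iic]
  have hmeas : ∀ γ : Measure ℝ, IsFiniteMeasure γ → Measurable fun y => γ (Iic (t - y)) :=
    fun γ _ => Antitone.measurable fun y z hyz => measure_mono (Iic_subset_Iic.2 (by linarith))
  have hint : ∀ γ : Measure ℝ, IsFiniteMeasure γ → Integrable (fun y => γ.real (Iic (t - y))) ν := by
    intro γ hγ
    refine Integrable.of_bound (hmeas γ hγ).ennreal_toReal.aestronglyMeasurable (γ.real univ)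
      (Filter.Eventually.of_forall fun y => ?_)
    rw [Real.norm_of_nonneg measureReal_nonneg]
    exact measureReal_mono (subset_univ _)
  have hconv : ∀ γ : Measure ℝ, IsFiniteMeasure γ →
      ∫ y, γ.real (Iic (t - y)) ∂ν = (Measure.conv ν γ).real (Iic t) := by
    intro γ hγ
    rw [measureReal_def, conv_apply_Iic]
    exact integral_toReal (hmeas γ hγ).aemeasurable
      (Filter.Eventually.of_forall fun y => measure_lt_top _ _)
  simp_rw [hset]
  rw [integral_sub (hint α fα) (hint β fβ), hconv α fα, hconv β fβ, hchar,
    measureReal_add_apply]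
  ring

/-! ### Derivatives of products and cutoff functions -/

lemma norm_iteratedDeriv_mul_le {𝕂 : Type*} [RCLike 𝕂] {f g : ℝ → 𝕂} {n : ℕ} {x A B : ℝ}
    (hf : ContDiffAt ℝ n f x) (hg : ContDiffAt ℝ n g x)
    (hA : ∀ i ≤ n, ‖iteratedDeriv i f x‖ ≤ A) (hB : ∀ i ≤ n, ‖iteratedDeriv i g x‖ ≤ B) :
    ‖iteratedDeriv n (fun v => f v * g v) x‖ ≤ 2 ^ n * (A * B) := by
  have hA0 : 0 ≤ A := (norm_nonneg _).trans (hA 0 (Nat.zero_le _))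
  rw [iteratedDeriv_fun_mul hf hg]
  calc _ ≤ ∑ i ∈ Finset.range (n + 1), (n.choose i : ℝ) * (A * B) := by
        refine norm_sum_le_of_le _ fun i hi => ?_
        rw [Finset.mem_range] at hi
        rw [mul_assoc, norm_mul, norm_mul, RCLike.norm_natCast]
        gcongr
        · exact hA i (by omega)
        · exact hB _ (by omega)
    _ = _ := by
        rw [← Finset.sum_mul]
        congr 1
        exact_mod_cast Nat.sum_range_choose n

lemma norm_iteratedDeriv_ofReal {f : ℝ → ℝ} {n : ℕ} {x : ℝ} (hf : ContDiffAt ℝ n f x) :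
    ‖iteratedDeriv n (fun v => (f v : ℂ)) x‖ = ‖iteratedDeriv n f x‖ := by
  have h := Complex.ofRealLI.norm_iteratedFDeriv_comp_left hf (i := n) le_rfl
  rwa [norm_iteratedFDeriv_eq_norm_iteratedDeriv, norm_iteratedFDeriv_eq_norm_iteratedDeriv] at h

/-- A smooth function equal to one on `[-1, 1]` and vanishing outside `[-2, 2]`. -/
noncomputable def cutoff : ContDiffBump (0 : ℝ) := ⟨1, 2, one_pos, one_lt_two⟩

lemma cutoff_eq_one {v : ℝ} (hv : |v| ≤ 1) : cutoff v = 1 :=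
  cutoff.one_of_mem_closedBall (by simpa [cutoff] using hv)

lemma cutoff_eq_zero {v : ℝ} (hv : 2 ≤ |v|) : cutoff v = 0 :=
  cutoff.zero_of_le_dist (by simpa [cutoff] using hv)

lemma contDiff_cutoff (n : ℕ) : ContDiff ℝ n cutoff := by
  have := cutoff.contDiff (n := (n : ℕ∞))
  exact_mod_cast this

noncomputable def lowCut (v : ℝ) : ℂ := (cutoff v : ℝ)

/-- Chosen so that multiplication by `-iv`, the symbol of differentiation, gives `1 - lowCut`. The
junk value of `v⁻¹` at `0` is harmless because `1 - cutoff` vanishes near the origin. -/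
noncomputable def highCut (v : ℝ) : ℂ := Complex.I * ((1 - cutoff v) * v⁻¹ : ℝ)

lemma contDiff_lowCut (n : ℕ) : ContDiff ℝ n lowCut :=
  Complex.ofRealCLM.contDiff.comp (contDiff_cutoff n)

lemma lowCut_eq_zero {v : ℝ} (hv : 2 < |v|) : lowCut v = 0 := by
  simp [lowCut, cutoff_eq_zero hv.le]

lemma highCut_eq_zero {v : ℝ} (hv : |v| ≤ 1) : highCut v = 0 := by
  simp [highCut, cutoff_eq_one hv]

lemma neg_I_mul_highCut (v : ℝ) : -Complex.I * v * highCut v = 1 - lowCut v := by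
  rcases eq_or_ne v 0 with rfl | hv
  · simp [lowCut, cutoff_eq_one (v := 0) (by simp)]
  · have hv' : (v : ℂ) ≠ 0 := by exact_mod_cast hv
    simp only [highCut, lowCut]
    push_cast
    field_simp
    rw [Complex.I_sq]
    ring

lemma contDiffAt_highCut_real {v : ℝ} (hv : v ≠ 0) (n : ℕ) :
    ContDiffAt ℝ n (fun v => (1 - cutoff v) * v⁻¹) v :=
  (contDiffAt_const.sub (contDiff_cutoff n).contDiffAt).mul (contDiffAt_inv ℝ hv)

lemma contDiff_highCut (n : ℕ) : ContDiff ℝ n highCut := by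
  rw [contDiff_iff_contDiffAt]
  intro v
  by_cases hv : v = 0
  · have he : highCut =ᶠ[nhds v] fun _ => 0 := by
      filter_upwards [(continuous_abs.tendsto v).eventually
        (gt_mem_nhds (show |v| < 1 by simp [hv]))] with u hu
      exact highCut_eq_zero hu.le
    exact contDiffAt_const.congr_of_eventuallyEq he
  · exact contDiffAt_const.mul
      (Complex.ofRealCLM.contDiff.contDiffAt.comp v (contDiffAt_highCut_real hv n))

lemma exists_norm_iteratedDeriv_le_of_hasCompactSupport {f : ℝ → ℂ} {n : ℕ} (hf : ContDiff ℝ n f)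
    (hc : HasCompactSupport f) : ∃ C : ℝ≥0, ∀ l ≤ n, ∀ v, ‖iteratedDeriv l f v‖ ≤ C := by
  have h : ∀ l : ℕ, ∃ C : ℝ≥0, l ≤ n → ∀ v, ‖iteratedDeriv l f v‖ ≤ C := by
    intro l
    by_cases hl : l ≤ n
    · obtain ⟨C, hC⟩ := (hasCompactSupport_iteratedDeriv hc l).exists_bound_of_continuous
        (hf.continuous_iteratedDeriv l (by exact_mod_cast hl))
      exact ⟨⟨C, (norm_nonneg _).trans (hC 0)⟩, fun _ => hC⟩
    · exact ⟨0, fun h => absurd h hl⟩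
  choose C hC using h
  refine ⟨∑ l ∈ Finset.range (n + 1), C l, fun l hl v => (hC l hl v).trans ?_⟩
  exact_mod_cast Finset.single_le_sum (f := C) (fun i _ => zero_le)
    (Finset.mem_range.2 (by omega))

lemma exists_norm_iteratedDeriv_lowCut_le (n : ℕ) :
    ∃ C : ℝ≥0, ∀ l ≤ n, ∀ v, ‖iteratedDeriv l lowCut v‖ ≤ C :=
  exists_norm_iteratedDeriv_le_of_hasCompactSupport (contDiff_lowCut n)
    (hasCompactSupport_of_eq_zero_outside fun _ hv => lowCut_eq_zero hv)

lemma norm_iteratedDeriv_inv_le {n l : ℕ} (hl : l ≤ n) {v : ℝ} (hv : 1 < |v|) :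
    ‖iteratedDeriv l (fun v : ℝ => v⁻¹) v‖ ≤ n.factorial / |v| := by
  have h1 : iteratedDeriv l (fun v : ℝ => v⁻¹) v = (-1) ^ l * l.factorial * v ^ (-1 - l : ℤ) := by
    rw [iteratedDeriv_eq_iterate]
    exact iter_deriv_inv l v
  have hv0 : v ≠ 0 := by rintro rfl; simp at hv; linarith
  rw [h1, norm_mul, norm_mul, norm_pow, norm_neg, norm_one, one_pow, one_mul, norm_zpow,
    Real.norm_eq_abs, Real.norm_eq_abs, Nat.abs_cast, div_eq_mul_inv]
  gcongr
  rw [← zpow_neg_one]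
  exact zpow_le_zpow_right₀ hv.le (by omega)

/-- By Leibniz every derivative keeps the decay `1/|v|`, since further derivatives of `v⁻¹` are no
larger in order when `|v| > 1`. Squared, this is the weight in `A₃` and `A₄`. -/
lemma exists_norm_iteratedDeriv_highCut_le (n : ℕ) :
    ∃ C : ℝ≥0, ∀ l ≤ n, ∀ v, 1 < |v| → ‖iteratedDeriv l highCut v‖ ≤ C / |v| := by
  obtain ⟨C, hC⟩ := exists_norm_iteratedDeriv_lowCut_le n
  refine ⟨2 ^ n * ((1 + C) * n.factorial), fun l hl v hv => ?_⟩
  have hv0 : v ≠ 0 := by rintro rfl; simp at hv; linarith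
  have h1 : ∀ i ≤ l, ‖iteratedDeriv i (fun v => 1 - cutoff v) v‖ ≤ 1 + C := by
    intro i hi
    have h2 : ‖iteratedDeriv i cutoff v‖ ≤ C := by
      rw [← norm_iteratedDeriv_ofReal (contDiff_cutoff i).contDiffAt]
      exact hC i (hi.trans hl) v
    rcases Nat.eq_zero_or_pos i with rfl | hi0
    · simp only [iteratedDeriv_zero] at h2 ⊢
      refine (norm_sub_le _ _).trans ?_
      rw [norm_one]
      gcongr
    · rw [iteratedDeriv_const_sub hi0, iteratedDeriv_neg, norm_neg]
      linarith
  have h3 := norm_iteratedDeriv_mul_le (n := l) (x := v)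
    (contDiffAt_const.sub (contDiff_cutoff l).contDiffAt) (contDiffAt_inv ℝ hv0) h1
    (fun i hi => norm_iteratedDeriv_inv_le (hi.trans hl) hv)
  have h4 : iteratedDeriv l highCut v =
      Complex.I * iteratedDeriv l (fun v => (((1 - cutoff v) * v⁻¹ : ℝ) : ℂ)) v :=
    iteratedDeriv_const_mul_field _ _
  rw [h4, norm_mul, Complex.norm_I, one_mul,
    norm_iteratedDeriv_ofReal (contDiffAt_highCut_real hv0 l)]
  refine h3.trans ?_
  push_cast
  rw [mul_div_assoc, mul_div_assoc]
  gcongr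
  norm_num

/-! ### The symbols of the low and high frequency parts -/

/-- The rescaled transform of the kernel. -/
noncomputable def scaledStar (k : ℝ → ℝ) (h v : ℝ) : ℂ := fourierStar k (-h * v)

lemma contDiff_scaledStar {p : ℝ} {k : ℝ → ℝ} (hk : IsKernel p k) (h : ℝ) :
    ContDiff ℝ (⌈p⌉₊ : ℕ) (scaledStar k h) :=
  hk.contDiff.comp (contDiff_const.mul contDiff_id)

lemma scaledStar_eq_zero {p : ℝ} {k : ℝ → ℝ} (hk : IsKernel p k) {h v : ℝ} (hh : 0 < h)
    (hv : 1 / h < |v|) : scaledStar k h v = 0 := by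
  refine hk.support _ ?_
  rw [abs_mul, abs_neg, abs_of_pos hh]
  rwa [div_lt_iff₀' hh] at hv

/-- Each derivative of `v ↦ k^*(-hv)` brings out a factor `-h`, and `h ≤ 1` makes all bounds uniform
in the bandwidth. Lipschitz bounds below the top order come from the next derivative, at the top
order from the hypothesis on the kernel. -/
lemma exists_scaledStar_bound {p : ℝ} {k : ℝ → ℝ} (hk : IsKernel p k) :
    ∃ M : ℝ≥0, ∀ h : ℝ, 0 < h → h ≤ 1 → ∀ l ≤ ⌈p⌉₊,
      (∀ v, ‖iteratedDeriv l (scaledStar k h) v‖ ≤ M) ∧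
        LipschitzWith M (iteratedDeriv l (scaledStar k h)) := by
  obtain ⟨C, hC⟩ := exists_norm_iteratedDeriv_le_of_hasCompactSupport hk.contDiff
    (hasCompactSupport_of_eq_zero_outside hk.support)
  obtain ⟨L, hL⟩ := hk.lipschitz
  have hlip : ∀ l ≤ ⌈p⌉₊, LipschitzWith (C + L) (iteratedDeriv l (fourierStar k)) := by
    intro l hl
    rcases hl.lt_or_eq with hl | rfl
    · refine (lipschitzWith_of_nnnorm_deriv_le (C := C)
        (hk.contDiff.differentiable_iteratedDeriv l (by exact_mod_cast hl)) fun x => ?_).weaken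
        le_self_add
      rw [← iteratedDeriv_succ]
      exact hC (l + 1) hl x
    · exact hL.weaken le_add_self
  refine ⟨C + L, fun h hh hh1 l hl => ?_⟩
  have e : iteratedDeriv l (scaledStar k h) =
      fun x => (-h) ^ l • iteratedDeriv l (fourierStar k) (-h * x) :=
    iteratedDeriv_comp_const_smul (hk.contDiff.of_le (by exact_mod_cast hl)) (-h)
  have hpow : ‖(-h) ^ l‖ ≤ 1 := by
    rw [norm_pow, norm_neg, Real.norm_of_nonneg hh.le]
    exact pow_le_one₀ hh.le hh1
  constructor
  · intro v
    rw [e]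
    simp only
    rw [norm_smul]
    push_cast
    calc _ ≤ 1 * (C : ℝ) := by gcongr; exact hC l hl _
      _ ≤ _ := by rw [one_mul]; linarith [L.2]
  · rw [e]
    refine LipschitzWith.of_dist_le_mul fun x y => ?_
    rw [dist_smul₀]
    have h1 := (hlip l hl).dist_le_mul (-h * x) (-h * y)
    have h2 : dist (-h * x) (-h * y) ≤ dist x y := by
      rw [Real.dist_eq, Real.dist_eq, ← mul_sub, abs_mul, abs_neg, abs_of_pos hh]
      exact mul_le_of_le_one_left (abs_nonneg _) hh1
    calc _ ≤ 1 * (((C + L : ℝ≥0) : ℝ) * dist x y) := by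
          gcongr
          exact h1.trans (by gcongr)
      _ = _ := one_mul _

noncomputable def lowSymbol (k : ℝ → ℝ) (r : ℝ → ℂ) (h v : ℝ) : ℂ :=
  scaledStar k h v * (r v * lowCut v)

/-- Through `highCut` this symbol already contains the division by `-iv`: it represents the
primitive of the high frequencies, whereas `lowSymbol` represents a density still to be integrated.
-/
noncomputable def highSymbol (k : ℝ → ℝ) (r : ℝ → ℂ) (h v : ℝ) : ℂ :=
  scaledStar k h v * (r v * highCut v)

lemma lowSymbol_eq_zero (k : ℝ → ℝ) (r : ℝ → ℂ) (h : ℝ) {v : ℝ} (hv : 2 < |v|) :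
    lowSymbol k r h v = 0 := by simp [lowSymbol, lowCut_eq_zero hv]

lemma contDiff_lowSymbol {p : ℝ} {k : ℝ → ℝ} (hk : IsKernel p k) {r : ℝ → ℂ} {m : ℕ}
    (hm : m ≤ ⌈p⌉₊) (hr : ContDiff ℝ m r) (h : ℝ) : ContDiff ℝ m (lowSymbol k r h) :=
  ((contDiff_scaledStar hk h).of_le (by exact_mod_cast hm)).mul (hr.mul (contDiff_lowCut m))

lemma contDiff_highSymbol {p : ℝ} {k : ℝ → ℝ} (hk : IsKernel p k) {r : ℝ → ℂ} {m : ℕ}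
    (hm : m ≤ ⌈p⌉₊) (hr : ContDiff ℝ m r) (h : ℝ) : ContDiff ℝ m (highSymbol k r h) :=
  ((contDiff_scaledStar hk h).of_le (by exact_mod_cast hm)).mul (hr.mul (contDiff_highCut m))

lemma exists_norm_iteratedDeriv_mul_lowCut_le (m : ℕ) :
    ∃ C : ℝ≥0, ∀ (r : ℝ → ℂ) (B : ℝ≥0), ContDiff ℝ m r →
      (∀ t ∈ Icc (-2 : ℝ) 2, ∀ l ≤ m, ‖iteratedDeriv l r t‖ ≤ B) →
      ∀ l ≤ m, ∀ v, ‖iteratedDeriv l (fun v => r v * lowCut v) v‖ ≤ C * B := by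
  obtain ⟨C, hC⟩ := exists_norm_iteratedDeriv_lowCut_le m
  refine ⟨2 ^ m * C, fun r B hr hB l hl v => ?_⟩
  by_cases hv : 2 < |v|
  · rw [iteratedDeriv_eq_zero_of_eq_zero_outside (a := 2)
      (fun u hu => by simp [lowCut_eq_zero hu]) l v hv, norm_zero]
    positivity
  · have h := norm_iteratedDeriv_mul_le (n := l) (x := v)
      (hr.of_le (by exact_mod_cast hl)).contDiffAt (contDiff_lowCut l).contDiffAt
      (fun i hi => hB v (abs_le.1 (not_lt.1 hv)) i (hi.trans hl))
      (fun i hi => hC i (hi.trans hl) v)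
    refine h.trans ?_
    push_cast
    rw [mul_assoc, mul_comm (B : ℝ)]
    gcongr
    norm_num

lemma sq_rpow_half (x : ℝ≥0∞) : (x ^ 2) ^ (1 / 2 : ℝ) = x := by
  rw [← ENNReal.rpow_natCast, ← ENNReal.rpow_mul]
  norm_num

lemma lintegral_enorm_sq_le_of_bounded {f : ℝ → ℂ} {D : ℝ≥0} (hf : ∀ v, ‖f v‖ ≤ D)
    (hs : ∀ v, 2 < |v| → f v = 0) : ∫⁻ v, ‖f v‖ₑ ^ 2 ≤ 4 * (D : ℝ≥0∞) ^ 2 := by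
  calc ∫⁻ x, ‖f x‖ₑ ^ 2 ≤ ∫⁻ x, (Icc (-2 : ℝ) 2).indicator (fun _ => (D : ℝ≥0∞) ^ 2) x := by
        refine lintegral_mono fun x => ?_
        by_cases hx : x ∈ Icc (-2 : ℝ) 2
        · rw [indicator_of_mem hx]
          gcongr
          rw [← ofReal_norm]
          exact ENNReal.ofReal_le_of_le_toReal (by simpa using hf x)
        · rw [hs x (not_le.1 fun h => hx (abs_le.1 h))]; simp
    _ = _ := by
        rw [lintegral_indicator measurableSet_Icc, setLIntegral_const, Real.volume_Icc, mul_comm]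
        norm_num

/-- Integrability of the low frequency part. -/
lemma exists_lintegral_ft_lowSymbol_le {p : ℝ} (hp : 1 ≤ p) {k : ℝ → ℝ} (hk : IsKernel p k) :
    ∃ C : ℝ≥0, ∀ (h : ℝ) (r : ℝ → ℂ) (B : ℝ≥0), 0 < h → h ≤ 1 → ContDiff ℝ 1 r →
      (∀ t ∈ Icc (-2 : ℝ) 2, ∀ l ≤ 1, ‖iteratedDeriv l r t‖ ≤ B) →
      ∫⁻ x, ‖ft (lowSymbol k r h) x‖ₑ ≤ C * B := by
  obtain ⟨M, hM⟩ := exists_scaledStar_bound hk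
  obtain ⟨C₁, hC₁⟩ := exists_norm_iteratedDeriv_mul_lowCut_le 1
  obtain ⟨C₂, hC₂⟩ := exists_lintegral_rpow_mul_enorm_le (q := 0) (m := 1) le_rfl (by norm_num)
  have hp1 : 1 ≤ ⌈p⌉₊ := Nat.one_le_ceil_iff.2 (by linarith)
  -- Here `2π` is the Plancherel constant, `4` the length of `[-2, 2]`, and `2` counts the symbol
  -- and its derivative.
  set E : ℝ≥0∞ := ENNReal.ofReal (2 * Real.pi) * (4 * 2)
  have hE : E ≠ ∞ := ENNReal.mul_ne_top ENNReal.ofReal_ne_top (by norm_num)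
  refine ⟨C₂ * (E ^ (1 / 2 : ℝ)).toNNReal * (2 * M * C₁), fun h r B hh hh1 hr hB => ?_⟩
  set G := lowSymbol k r h
  have hr' : ContDiff ℝ (1 : ℕ) r := by exact_mod_cast hr
  have hG : ContDiff ℝ (1 : ℕ) G := contDiff_lowSymbol hk hp1 hr' h
  have hGs : ∀ v, 2 < |v| → G v = 0 := fun v hv => lowSymbol_eq_zero k r h hv
  have hGc := hasCompactSupport_of_eq_zero_outside hGs
  have hGb : ∀ l ≤ 1, ∀ v, ‖iteratedDeriv l G v‖ ≤ ((2 * M * C₁ * B : ℝ≥0) : ℝ) := by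
    intro l hl v
    have h1 := norm_iteratedDeriv_mul_le (n := l) (x := v)
      ((contDiff_scaledStar hk h).of_le (by exact_mod_cast hl.trans hp1)).contDiffAt
      ((hr'.of_le (by exact_mod_cast hl)).mul (contDiff_lowCut l)).contDiffAt
      (fun i hi => (hM h hh hh1 i ((hi.trans hl).trans hp1)).1 v)
      (fun i hi => hC₁ r B hr' hB i (hi.trans hl) v)
    refine h1.trans ?_
    push_cast
    calc (2 : ℝ) ^ l * (M * (C₁ * B)) ≤ 2 ^ 1 * (M * (C₁ * B)) := by gcongr; norm_num
      _ = _ := by ring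
  have hcont : Continuous (ft G) :=
    continuous_ft (hG.continuous.integrable_of_hasCompactSupport hGc)
  have h2 := hC₂ _ hcont.measurable
  simp only [Real.rpow_zero, ENNReal.ofReal_one, one_mul] at h2
  rw [lintegral_pow_mul_enorm_sq_ft hG hGc, lintegral_enorm_sq_ft hG.continuous hGc] at h2
  refine h2.trans ?_
  push_cast
  rw [ENNReal.coe_toNNReal (ENNReal.rpow_ne_top_of_nonneg (by norm_num) hE), mul_assoc, mul_assoc]
  gcongr
  have h3 := lintegral_enorm_sq_le_of_bounded
    (D := 2 * M * C₁ * B) (by simpa using hGb 0 (by norm_num)) hGs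
  have h4 := lintegral_enorm_sq_le_of_bounded (hGb 1 le_rfl)
    (iteratedDeriv_eq_zero_of_eq_zero_outside hGs 1)
  set D : ℝ≥0∞ := ((2 * M * C₁ * B : ℝ≥0) : ℝ≥0∞) with hDdef
  have hD : (2 * M * C₁ : ℝ≥0∞) * B = (D ^ 2) ^ (1 / 2 : ℝ) := by
    rw [sq_rpow_half, hDdef]
    push_cast
    ring
  rw [hD, ← ENNReal.mul_rpow_of_nonneg _ _ (by norm_num)]
  gcongr
  calc _ ≤ ENNReal.ofReal (2 * Real.pi) * (4 * D ^ 2) + ENNReal.ofReal (2 * Real.pi) * (4 * D ^ 2) :=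
        by gcongr
    _ = _ := by simp only [E]; ring

lemma lipschitzWith_mul_of_bounded {f g : ℝ → ℂ} {A B : ℝ≥0} (hf : LipschitzWith A f)
    (hg : LipschitzWith B g) (hfb : ∀ v, ‖f v‖ ≤ A) (hgb : ∀ v, ‖g v‖ ≤ B) :
    LipschitzWith (2 * (A * B)) fun v => f v * g v := by
  refine LipschitzWith.of_dist_le_mul fun x y => ?_
  rw [dist_eq_norm]
  have e : f x * g x - f y * g y = f x * (g x - g y) + (f x - f y) * g y := by ring
  have h1 := hf.dist_le_mul x y
  have h2 := hg.dist_le_mul x y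
  rw [dist_eq_norm] at h1 h2
  rw [e]
  calc _ ≤ ‖f x‖ * ‖g x - g y‖ + ‖f x - f y‖ * ‖g y‖ := by
        refine (norm_add_le _ _).trans ?_
        rw [norm_mul, norm_mul]
    _ ≤ A * (B * dist x y) + (A * dist x y) * B := by
        gcongr
        · exact hfb x
        · exact hgb y
    _ = _ := by push_cast; ring

/-- Weighted integrability of the low frequency part. -/
lemma exists_lintegral_rpow_mul_ft_lowSymbol_le {p : ℝ} (hp : 1 ≤ p) {k : ℝ → ℝ}
    (hk : IsKernel p k) {m : ℕ} (hm : m ≤ ⌈p⌉₊) (hpm : p + 1 / 2 < m + 1) :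
    ∃ C : ℝ≥0, ∀ (h : ℝ) (r : ℝ → ℂ) (B : ℝ≥0), 0 < h → h ≤ 1 → ContDiff ℝ (m + 1 : ℕ) r →
      (∀ t ∈ Icc (-2 : ℝ) 2, ∀ l ≤ m + 1, ‖iteratedDeriv l r t‖ ≤ B) →
      ∫⁻ x, ENNReal.ofReal (|x| ^ p) * ‖ft (lowSymbol k r h) x‖ₑ ≤ C * B := by
  obtain ⟨M, hM⟩ := exists_scaledStar_bound hk
  obtain ⟨C₁, hC₁⟩ := exists_norm_iteratedDeriv_mul_lowCut_le (m + 1)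
  obtain ⟨C₂, hC₂⟩ := exists_lintegral_rpow_mul_enorm_le (q := p) (m := m + 1) (by linarith)
    (by exact_mod_cast hpm)
  -- The `10` is `4 + 6`: the length of `[-2, 2]` for the symbol, and of `[-3, 3]` for the
  -- difference quotients of its `m`-th derivative.
  set E : ℝ≥0∞ := ENNReal.ofReal (2 * Real.pi) * 10
  have hE : E ≠ ∞ := ENNReal.mul_ne_top ENNReal.ofReal_ne_top (by norm_num)
  refine ⟨C₂ * (E ^ (1 / 2 : ℝ)).toNNReal * (2 ^ m * (2 * (M * C₁))),
    fun h r B hh hh1 hr hB => ?_⟩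
  set G := lowSymbol k r h
  have hrm : ContDiff ℝ m r := hr.of_le (by exact_mod_cast Nat.le_succ m)
  have hG : ContDiff ℝ m G := contDiff_lowSymbol hk hm hrm h
  have hGs : ∀ v, 2 < |v| → G v = 0 := fun v hv => lowSymbol_eq_zero k r h hv
  have hGc := hasCompactSupport_of_eq_zero_outside hGs
  have hρ := hC₁ r B hr hB
  have hG0 : ∀ v, ‖G v‖ ≤ ((2 ^ m * (2 * (M * (C₁ * B))) : ℝ≥0) : ℝ) := by
    intro v
    have h1 := (hM h hh hh1 0 (Nat.zero_le _)).1 v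
    have h2 := hρ 0 (Nat.zero_le _) v
    simp only [iteratedDeriv_zero] at h1 h2
    simp only [G, lowSymbol]
    rw [norm_mul]
    push_cast
    calc _ ≤ (M : ℝ) * (C₁ * B) := by gcongr
      _ ≤ 2 ^ m * (2 * (M * (C₁ * B))) := by
        have : (1 : ℝ) ≤ 2 ^ m := one_le_pow₀ (by norm_num)
        have h0 : (0 : ℝ) ≤ M * (C₁ * B) := by positivity
        nlinarith
  -- In each Leibniz term the kernel factor has order at most `m ≤ ⌈p⌉`, hence is Lipschitz, and the
  -- other factor is Lipschitz because `r` has `m + 1` derivatives. Thus `m + 1` derivatives of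
  -- `k^*` are not required.
  have hGL : LipschitzWith (2 ^ m * (2 * (M * (C₁ * B)))) (iteratedDeriv m G) := by
    have e : iteratedDeriv m G = fun v => ∑ i ∈ Finset.range (m + 1), (m.choose i : ℂ) *
        (iteratedDeriv i (scaledStar k h) v *
          iteratedDeriv (m - i) (fun v => r v * lowCut v) v) := by
      ext v
      have := iteratedDeriv_fun_mul (n := m) (x := v)
        ((contDiff_scaledStar hk h).of_le (by exact_mod_cast hm)).contDiffAt
        (hrm.mul (contDiff_lowCut m)).contDiffAt
      simp only [mul_assoc] at this
      exact this
    rw [e]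
    refine LipschitzWith.of_dist_le_mul fun x y => ?_
    rw [dist_eq_norm, ← Finset.sum_sub_distrib]
    have hs : (2 : ℝ) ^ m = ∑ i ∈ Finset.range (m + 1), (m.choose i : ℝ) := by
      exact_mod_cast (Nat.sum_range_choose m).symm
    push_cast
    rw [hs, Finset.sum_mul, Finset.sum_mul]
    refine norm_sum_le_of_le _ fun i hi => ?_
    rw [Finset.mem_range] at hi
    have hd : Differentiable ℝ (iteratedDeriv (m - i) (fun v => r v * lowCut v)) :=
      (hr.mul (contDiff_lowCut (m + 1))).differentiable_iteratedDeriv _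
        (by exact_mod_cast (by omega : m - i < m + 1))
    have hl2 : LipschitzWith (C₁ * B) (iteratedDeriv (m - i) (fun v => r v * lowCut v)) := by
      refine lipschitzWith_of_nnnorm_deriv_le hd fun x => ?_
      rw [← iteratedDeriv_succ]
      exact hρ _ (by omega) x
    have hK := hM h hh hh1 i (by omega)
    have h5 := (lipschitzWith_mul_of_bounded hK.2 hl2 hK.1
      (fun v => hρ _ (by omega) v)).dist_le_mul x y
    rw [dist_eq_norm] at h5
    rw [← mul_sub, norm_mul, Complex.norm_natCast, mul_assoc]
    gcongr
    exact_mod_cast h5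
  have hcont : Continuous (ft G) :=
    continuous_ft (hG.continuous.integrable_of_hasCompactSupport hGc)
  refine (hC₂ _ hcont.measurable).trans ?_
  have h3 := lintegral_enorm_sq_le_of_bounded hG0 hGs
  have h4 := lintegral_pow_succ_mul_enorm_sq_ft_le hG hGL hGs
  push_cast
  rw [ENNReal.coe_toNNReal (ENNReal.rpow_ne_top_of_nonneg (by norm_num) hE), mul_assoc, mul_assoc]
  gcongr
  rw [lintegral_enorm_sq_ft hG.continuous hGc]
  set D : ℝ≥0∞ := ((2 ^ m * (2 * (M * (C₁ * B))) : ℝ≥0) : ℝ≥0∞) with hDdef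
  have hD : (2 ^ m * (2 * (M * C₁)) : ℝ≥0∞) * B = (D ^ 2) ^ (1 / 2 : ℝ) := by
    rw [sq_rpow_half, hDdef]
    push_cast
    ring
  rw [hD, ← ENNReal.mul_rpow_of_nonneg _ _ (by norm_num)]
  gcongr
  calc _ ≤ ENNReal.ofReal (2 * Real.pi) * (4 * D ^ 2) + ENNReal.ofReal (2 * Real.pi) * (6 * D ^ 2) :=
        by gcongr
    _ = _ := by simp only [E]; ring

/-- Square integrability of the derivatives of the high frequency symbol. -/
lemma exists_lintegral_iteratedDeriv_highSymbol_le {p : ℝ} {k : ℝ → ℝ} (hk : IsKernel p k)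
    {m : ℕ} (hm : m ≤ ⌈p⌉₊) :
    ∃ C : ℝ≥0, ∀ (h : ℝ) (r : ℝ → ℂ), 0 < h → h ≤ 1 → ContDiff ℝ m r → ∀ l ≤ m,
      ∫⁻ v, ‖iteratedDeriv l (highSymbol k r h) v‖ₑ ^ 2 ≤
        C * ∑ j ∈ Finset.range (l + 1), outerIntegral r h j := by
  obtain ⟨M, hM⟩ := exists_scaledStar_bound hk
  obtain ⟨C₁, hC₁⟩ := exists_norm_iteratedDeriv_highCut_le m
  refine ⟨(2 ^ m * 2 ^ m * M * C₁) ^ 2 * (m + 1), fun h r hh hh1 hr l hl => ?_⟩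
  set S : Set ℝ := Icc (-(1 / h)) (1 / h) ∩ (Icc (-1 : ℝ) 1)ᶜ with hS
  have hSm : MeasurableSet S := measurableSet_Icc.inter measurableSet_Icc.compl
  set D : ℝ := 2 ^ m * 2 ^ m * M * C₁ with hD
  have hbound : ∀ v, 1 < |v| → ‖iteratedDeriv l (highSymbol k r h) v‖ ≤
      D / |v| * ∑ j ∈ Finset.range (l + 1), ‖iteratedDeriv j r v‖ := by
    intro v hv
    have h1 : ∀ i ≤ l, ‖iteratedDeriv i (fun v => r v * highCut v) v‖ ≤
        2 ^ m * ((∑ j ∈ Finset.range (l + 1), ‖iteratedDeriv j r v‖) * (C₁ / |v|)) := by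
      intro i hi
      refine (norm_iteratedDeriv_mul_le (n := i) (x := v)
        (A := ∑ j ∈ Finset.range (l + 1), ‖iteratedDeriv j r v‖) (B := C₁ / |v|)
        (hr.of_le (by exact_mod_cast hi.trans hl)).contDiffAt
        (contDiff_highCut i).contDiffAt (fun j hj => ?_)
        (fun j hj => hC₁ j ((hj.trans hi).trans hl) v hv)).trans ?_
      · exact Finset.single_le_sum (f := fun j => ‖iteratedDeriv j r v‖)
          (fun j _ => norm_nonneg _) (Finset.mem_range.2 (by omega))
      · gcongr
        · norm_num
        · exact hi.trans hl
    have h2 := norm_iteratedDeriv_mul_le (n := l) (x := v)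
      ((contDiff_scaledStar hk h).of_le (by exact_mod_cast hl.trans hm)).contDiffAt
      ((hr.of_le (by exact_mod_cast hl)).mul (contDiff_highCut l)).contDiffAt
      (fun i hi => (hM h hh hh1 i ((hi.trans hl).trans hm)).1 v) h1
    refine h2.trans ?_
    calc _ ≤ (2 : ℝ) ^ m * (M * (2 ^ m *
          ((∑ j ∈ Finset.range (l + 1), ‖iteratedDeriv j r v‖) * (C₁ / |v|)))) := by
          gcongr
          norm_num
      _ = _ := by rw [hD]; ring
  have hz1 : ∀ v, |v| < 1 → iteratedDeriv l (highSymbol k r h) v = 0 := by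
    intro v hv
    have he : highSymbol k r h =ᶠ[nhds v] fun _ => 0 := by
      filter_upwards [(continuous_abs.tendsto v).eventually (gt_mem_nhds hv)] with u hu
      simp [highSymbol, highCut_eq_zero (le_of_lt hu)]
    rw [he.iteratedDeriv_eq]
    simp
  have hz2 : ∀ v, 1 / h < |v| → iteratedDeriv l (highSymbol k r h) v = 0 :=
    iteratedDeriv_eq_zero_of_eq_zero_outside
      (fun v hv => by simp [highSymbol, scaledStar_eq_zero hk hh hv]) l
  have hpt : ∀ᵐ v, ‖iteratedDeriv l (highSymbol k r h) v‖ₑ ^ 2 ≤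
      S.indicator (fun v => ENNReal.ofReal (D ^ 2 * (m + 1)) *
        ∑ j ∈ Finset.range (l + 1), ENNReal.ofReal (‖iteratedDeriv j r v‖ ^ 2 / |v| ^ 2)) v := by
    -- At `v = ±1` the right side is zero, while the vanishing of the derivative has been shown only
    -- for `|v| < 1` and `|v| > 1/h`; two points are negligible.
    have hne : ∀ᵐ v : ℝ, v ∉ ({1, -1} : Set ℝ) :=
      measure_eq_zero_iff_ae_notMem.1 ((Set.toFinite _).measure_zero _)
    filter_upwards [hne] with v hv
    by_cases hvS : v ∈ S
    · rw [indicator_of_mem hvS]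
      have hv1 : 1 < |v| := not_le.1 fun h => hvS.2 (abs_le.1 h)
      rw [← ofReal_norm, ← ENNReal.ofReal_pow (norm_nonneg _),
        ← ENNReal.ofReal_sum_of_nonneg (fun j _ => by positivity),
        ← ENNReal.ofReal_mul (by positivity)]
      apply ENNReal.ofReal_le_ofReal
      calc _ ≤ (D / |v| * ∑ j ∈ Finset.range (l + 1), ‖iteratedDeriv j r v‖) ^ 2 := by
            gcongr; exact hbound v hv1
        _ = D ^ 2 / |v| ^ 2 * (∑ j ∈ Finset.range (l + 1), ‖iteratedDeriv j r v‖) ^ 2 := by ring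
        _ ≤ D ^ 2 / |v| ^ 2 * ((m + 1) * ∑ j ∈ Finset.range (l + 1), ‖iteratedDeriv j r v‖ ^ 2) := by
            gcongr
            refine sq_sum_le_card_mul_sum_sq.trans ?_
            gcongr
            rw [Finset.card_range]
            exact_mod_cast Nat.succ_le_succ hl
        _ = _ := by
            rw [← Finset.sum_div]; ring
    · rw [indicator_of_notMem hvS]
      have : |v| < 1 ∨ 1 / h < |v| := by
        by_contra hcon
        push Not at hcon
        have hv1 : |v| ≠ 1 := by
          intro h1
          rcases eq_or_eq_neg_of_abs_eq h1 with h | h <;> exact hv (by simp [h])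
        exact hvS ⟨abs_le.1 hcon.2, fun h1 => hv1 (le_antisymm (abs_le.2 h1) hcon.1)⟩
      rcases this with h1 | h1
      · rw [hz1 v h1]; simp
      · rw [hz2 v h1]; simp
  refine (lintegral_mono_ae hpt).trans (le_of_eq ?_)
  have hmeas : ∀ j ∈ Finset.range (l + 1),
      Measurable fun v => ENNReal.ofReal (‖iteratedDeriv j r v‖ ^ 2 / |v| ^ 2) := by
    intro j hj
    have hc : Continuous (iteratedDeriv j r) := hr.continuous_iteratedDeriv j
      (by exact_mod_cast (by rw [Finset.mem_range] at hj; omega : j ≤ m))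
    have := hc.measurable
    fun_prop
  rw [lintegral_indicator hSm, lintegral_const_mul' _ _ ENNReal.ofReal_ne_top,
    lintegral_finsetSum _ hmeas]
  congr 1
  rw [← ENNReal.ofReal_coe_nnreal]
  congr 1

/-! ### Structure of the preliminary estimator -/

/-- The symbol of the deconvolution operator. -/
noncomputable def symbol (k : ℝ → ℝ) (r : ℝ → ℂ) (h v : ℝ) : ℂ := scaledStar k h v * r v

/-- The real density `x ↦ Re (2π)⁻¹ ∫ e^{-ivx} g(v) dv`. -/
noncomputable def density (g : ℝ → ℂ) (x : ℝ) : ℝ := (1 / (2 * (Real.pi : ℂ)) * ft g x).re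

lemma abs_density_le (g : ℝ → ℂ) (x : ℝ) : |density g x| ≤ ‖ft g x‖ := by
  refine (Complex.abs_re_le_norm _).trans ?_
  rw [norm_mul]
  refine mul_le_of_le_one_left (norm_nonneg _) ?_
  rw [norm_div, norm_one, norm_mul, Complex.norm_real, Real.norm_of_nonneg Real.pi_pos.le,
    Complex.norm_ofNat, div_le_one (by positivity)]
  linarith [Real.pi_gt_three]

lemma continuous_density {g : ℝ → ℂ} (hg : Integrable g) : Continuous (density g) :=
  Complex.continuous_re.comp (continuous_const.mul (continuous_ft hg))

lemma integrable_density {g : ℝ → ℂ} (hg : ContDiff ℝ 1 g) (hc : HasCompactSupport g) :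
    Integrable (density g) :=
  ((integrable_ft hg hc).const_mul _).re

/-- The substitution `u = -hv` moves the bandwidth from the argument of `r_ε` to that of `k^*`. The
noise symbol is then independent of `h`. -/
lemma deconvKernel_eq (k : ℝ → ℝ) (με : Measure ℝ) {h : ℝ} (hh : 0 < h) (x : ℝ) :
    deconvKernel k με h (x / h) = h * density (symbol k (recipChar με) h) x := by
  have hh' : (h : ℂ) ≠ 0 := by exact_mod_cast hh.ne'
  have h1 := Measure.integral_comp_mul_left (fun u : ℝ =>
    Complex.exp (Complex.I * u * (x / h : ℝ)) * fourierStar k u / charFun με (-u / h)) (-h)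
  have h2 : ∀ v : ℝ, Complex.exp (Complex.I * (-h * v : ℝ) * (x / h : ℝ)) *
      fourierStar k (-h * v) / charFun με (-(-h * v) / h) =
      Complex.exp (-(Complex.I * v * x)) * symbol k (recipChar με) h v := by
    intro v
    have e1 : -(-h * v) / h = v := by field_simp
    have e2 : Complex.I * (-h * v : ℝ) * (x / h : ℝ) = -(Complex.I * v * x) := by
      push_cast
      field_simp
    rw [e1, e2, symbol, scaledStar, recipChar]
    ring
  simp only [h2] at h1
  rw [← ft_eq_integral, inv_neg, abs_neg, abs_of_pos (inv_pos.2 hh)] at h1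
  have h3 : ∫ u : ℝ, Complex.exp (Complex.I * u * (x / h : ℝ)) * fourierStar k u /
      charFun με (-u / h) = h * ft (symbol k (recipChar με) h) x := by
    rw [h1, Complex.real_smul, ← mul_assoc, ← Complex.ofReal_mul, mul_inv_cancel₀ hh.ne',
      Complex.ofReal_one, one_mul]
  rw [deconvKernel, h3, density, ← Complex.re_ofReal_mul]
  congr 1
  ring

/-- The primitive of a density. -/
noncomputable def primitive (a : ℝ → ℝ) (x : ℝ) : ℝ := ∫ u in Iic x, a u

lemma abs_primitive_le {a : ℝ → ℝ} (ha : Integrable a) (x : ℝ) :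
    |primitive a x| ≤ ∫ u, |a u| :=
  (norm_integral_le_integral_norm _).trans
    (setIntegral_le_integral ha.norm (Filter.Eventually.of_forall fun _ => norm_nonneg _))

lemma measurable_primitive {a : ℝ → ℝ} (ha : Continuous a) : Measurable (primitive a) := by
  have h : StronglyMeasurable fun z : ℝ × ℝ => {z : ℝ × ℝ | z.2 ≤ z.1}.indicator
      (fun z => a z.2) z :=
    ((ha.comp continuous_snd).stronglyMeasurable).indicator
      (measurableSet_le measurable_snd measurable_fst)
  have h2 := (h.integral_prod_right' (ν := volume)).measurable
  convert h2 using 2 with x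
  rw [primitive, ← integral_indicator measurableSet_Iic]
  rfl

lemma setIntegral_Iic_comp_sub (a : ℝ → ℝ) (t y : ℝ) :
    ∫ u in Iic t, a (u - y) = primitive a (t - y) := by
  have h := (measurePreserving_sub_right (volume : Measure ℝ) y).setIntegral_preimage_emb
    (MeasurableEquiv.subRight y).measurableEmbedding a (Iic (t - y))
  rw [primitive, ← h]
  congr 2
  ext u
  simp

lemma prelimEstimator_eq {n : ℕ} (k : ℝ → ℝ) (με : Measure ℝ) {h : ℝ} (hh : 0 < h)
    (hi : Integrable (density (symbol k (recipChar με) h))) (y : Fin n → ℝ) (t : ℝ) :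
    prelimEstimator k με h y t =
      1 / (n : ℝ) * ∑ j, primitive (density (symbol k (recipChar με) h)) (t - y j) := by
  simp only [prelimEstimator, deconvKernel_eq k με hh]
  rw [integral_finsetSum _ fun j _ => ((hi.comp_sub_right (y j)).const_mul h).integrableOn]
  simp only [integral_const_mul, setIntegral_Iic_comp_sub]
  rw [← Finset.mul_sum, ← mul_assoc]
  congr 1
  rw [one_div, one_div, mul_inv, mul_assoc, inv_mul_cancel₀ hh.ne', mul_one]

lemma conj_fourierStar (k : ℝ → ℝ) (x : ℝ) :
    (starRingEnd ℂ) (fourierStar k x) = fourierStar k (-x) := by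
  rw [fourierStar, fourierStar, ← integral_conj]
  congr with u
  rw [map_mul, ← Complex.exp_conj, Complex.conj_ofReal]
  congr 2
  simp

lemma fourierStar_neg {k : ℝ → ℝ} (hk : ∀ x, k (-x) = k x) (x : ℝ) :
    fourierStar k (-x) = fourierStar k x := by
  rw [fourierStar, fourierStar, ← integral_neg_eq_self]
  congr with u
  rw [hk]
  congr 2
  push_cast
  ring

lemma conj_symbol (k : ℝ → ℝ) (με : Measure ℝ) (h v : ℝ) :
    (starRingEnd ℂ) (symbol k (recipChar με) h (-v)) = symbol k (recipChar με) h v := by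
  rw [symbol, symbol, map_mul, scaledStar, scaledStar, conj_fourierStar, recipChar, recipChar,
    map_div₀, map_one, charFun_neg, Complex.conj_conj]
  congr 2
  ring

/-- Hermitian symmetry of the symbol makes its transform real, so the real part in `density`
discards nothing and Fourier inversion applies to it. -/
lemma ofReal_density {g : ℝ → ℂ} (hg : ∀ v, (starRingEnd ℂ) (g (-v)) = g v) (x : ℝ) :
    ((density g x : ℝ) : ℂ) = 1 / (2 * (Real.pi : ℂ)) * ft g x := by
  rw [density]
  refine Complex.conj_eq_iff_re.1 ?_
  rw [map_mul, map_div₀, map_one, map_mul, Complex.conj_ofReal, Complex.conj_ofNat]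
  congr 1
  rw [ft_eq_integral, ← integral_conj, ← integral_neg_eq_self]
  congr with v
  rw [map_mul, hg, ← Complex.exp_conj]
  congr 2
  simp

open scoped FourierTransform in
lemma integral_exp_mul_ft {g : ℝ → ℂ} (hg : ContDiff ℝ 1 g) (hc : HasCompactSupport g) (t : ℝ) :
    ∫ x : ℝ, Complex.exp (t * x * Complex.I) * (1 / (2 * (Real.pi : ℂ)) * ft g x) = g t := by
  have hpi : (0 : ℝ) < 2 * Real.pi := by positivity
  have hgi : Integrable g := hg.continuous.integrable_of_hasCompactSupport hc
  have hfi : Integrable (𝓕 g) := by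
    have h1 := (integrable_ft hg hc).comp_mul_left' hpi.ne'
    refine h1.congr (Filter.Eventually.of_forall fun x => ?_)
    simp only [ft]
    rw [mul_div_cancel_left₀ _ hpi.ne']
  have hinv := congrFun (hg.continuous.fourierInv_fourier_eq hgi hfi) t
  rw [← hinv, Real.fourierInv_eq']
  have h2 := Measure.integral_comp_mul_left (fun x : ℝ => Complex.exp (t * x * Complex.I) *
    (1 / (2 * (Real.pi : ℂ)) * ft g x)) (2 * Real.pi)
  rw [abs_of_pos (inv_pos.2 hpi)] at h2
  have h3 : ∫ x : ℝ, Complex.exp (t * x * Complex.I) * (1 / (2 * (Real.pi : ℂ)) * ft g x) =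
      (2 * Real.pi) • ∫ x : ℝ, Complex.exp (t * (2 * Real.pi * x : ℝ) * Complex.I) *
        (1 / (2 * (Real.pi : ℂ)) * ft g (2 * Real.pi * x)) := by
    rw [h2, smul_smul, mul_inv_cancel₀ hpi.ne', one_smul]
  rw [h3, ← integral_smul]
  congr with x
  have hpi' : (Real.pi : ℂ) ≠ 0 := by exact_mod_cast Real.pi_ne_zero
  rw [ft, mul_div_cancel_left₀ _ hpi.ne', Complex.real_smul, smul_eq_mul]
  push_cast
  have e : (t * (2 * Real.pi * x) * Complex.I : ℂ) =
      2 * Real.pi * ((inner ℝ x t : ℝ) : ℂ) * Complex.I := by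
    simp
    ring
  rw [e]
  field_simp

/-- The law of the kernel at bandwidth `h`. -/
noncomputable def kernelLaw (k : ℝ → ℝ) (h : ℝ) : Measure ℝ :=
  (volume.withDensity fun x => ENNReal.ofReal (k x)).map (h * ·)

lemma isProbabilityMeasure_kernelLaw {p : ℝ} {k : ℝ → ℝ} (hk : IsKernel p k) (h : ℝ) :
    IsProbabilityMeasure (kernelLaw k h) := by
  have : IsProbabilityMeasure (volume.withDensity fun x => ENNReal.ofReal (k x)) := by
    constructor
    rw [withDensity_apply _ MeasurableSet.univ, Measure.restrict_univ,
      ← ofReal_integral_eq_lintegral_ofReal hk.integrable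
        (Filter.Eventually.of_forall hk.nonneg), hk.integral_eq_one, ENNReal.ofReal_one]
  exact Measure.isProbabilityMeasure_map (by fun_prop)

lemma charFun_kernelLaw {p : ℝ} {k : ℝ → ℝ} (hk : IsKernel p k) (h t : ℝ) :
    charFun (kernelLaw k h) t = scaledStar k h t := by
  rw [kernelLaw, charFun_map_mul, charFun_withDensity_ofReal hk.integrable.aemeasurable,
    scaledStar, neg_mul, fourierStar_neg hk.symm, fourierStar]
  congr with x
  rw [max_eq_left (hk.nonneg x)]
  congr 2
  push_cast
  ring

lemma lintegral_rpow_kernelLaw {p : ℝ} {k : ℝ → ℝ} (hk : IsKernel p k) {h : ℝ}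
    (hh : 0 < h) :
    ∫⁻ z, ENNReal.ofReal (|z| ^ p) ∂(kernelLaw k h) =
      ENNReal.ofReal (h ^ p) * ∫⁻ x, ENNReal.ofReal (|x| ^ p * k x) := by
  rw [kernelLaw, lintegral_map (by fun_prop) (by fun_prop),
    lintegral_withDensity_eq_lintegral_mul₀ hk.integrable.aemeasurable.ennreal_ofReal
      (by fun_prop), ← lintegral_const_mul' _ _ ENNReal.ofReal_ne_top]
  refine lintegral_congr fun x => ?_
  simp only [Pi.mul_apply]
  rw [← ENNReal.ofReal_mul (hk.nonneg x), ← ENNReal.ofReal_mul (by positivity), abs_mul,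
    abs_of_pos hh, Real.mul_rpow hh.le (abs_nonneg x)]
  congr 1
  ring

lemma contDiff_symbol {p : ℝ} (hp : 1 ≤ p) {k : ℝ → ℝ} (hk : IsKernel p k) {r : ℝ → ℂ}
    (hr : ContDiff ℝ 1 r) (h : ℝ) : ContDiff ℝ 1 (symbol k r h) := by
  have hp1 : 1 ≤ ⌈p⌉₊ := Nat.one_le_ceil_iff.2 (by linarith)
  exact ((contDiff_scaledStar hk h).of_le (by exact_mod_cast hp1)).mul hr

lemma hasCompactSupport_symbol {p : ℝ} {k : ℝ → ℝ} (hk : IsKernel p k) (r : ℝ → ℂ) {h : ℝ}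
    (hh : 0 < h) : HasCompactSupport (symbol k r h) :=
  hasCompactSupport_of_eq_zero_outside (a := 1 / h) fun v hv => by
    simp [symbol, scaledStar_eq_zero hk hh hv]

/-- The preliminary estimator is unbiased for the distribution function of `μ ∗ kernelLaw k h`. -/
lemma integral_primitive_density_symbol {p : ℝ} (hp : 1 ≤ p) {k : ℝ → ℝ} (hk : IsKernel p k)
    {h : ℝ} (hh : 0 < h) (μ με : Measure ℝ) [IsProbabilityMeasure μ] [IsProbabilityMeasure με]
    (hne : ∀ t, charFun με t ≠ 0) (hr : ContDiff ℝ 1 (recipChar με)) (t : ℝ) :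
    ∫ y, primitive (density (symbol k (recipChar με) h)) (t - y) ∂(Measure.conv μ με) =
      cdf (Measure.conv μ (kernelLaw k h)) t := by
  have := isProbabilityMeasure_kernelLaw hk h
  have hg := contDiff_symbol hp hk hr h
  have hc := hasCompactSupport_symbol hk (recipChar με) hh
  rw [cdf_eq_real]
  refine integral_setIntegral_Iic_eq (integrable_density hg hc) _ _ (fun s => ?_) t
  simp only [ofReal_density (conj_symbol k με h)]
  -- The transform of the density is its symbol, whose factor `1/μ_ε^*` cancels against the noise;
  -- what remains is the characteristic function of `μ` convolved with the kernel law.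
  rw [integral_exp_mul_ft hg hc, charFun_conv, charFun_conv, charFun_kernelLaw hk, symbol,
    recipChar]
  have := hne s
  field_simp

/-! ### Low and high frequency decomposition of the primitive -/

lemma hasDerivAt_ft {g : ℝ → ℂ} (hg : Continuous g) (hc : HasCompactSupport g) (x : ℝ) :
    HasDerivAt (ft g) (ft (fun v => -Complex.I * v * g v) x) x := by
  have hpi : (Real.pi : ℂ) ≠ 0 := by exact_mod_cast Real.pi_ne_zero
  have hi : Integrable fun v : ℝ => v • g v :=
    (continuous_id.smul hg).integrable_of_hasCompactSupport hc.smul_left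
  have h1 := Real.hasDerivAt_fourier (hg.integrable_of_hasCompactSupport hc) hi (x / (2 * Real.pi))
  have h2 : HasDerivAt (fun x : ℝ => x / (2 * Real.pi)) (1 / (2 * Real.pi)) x :=
    (hasDerivAt_id x).div_const _
  have h3 := h1.scomp x h2
  have e : ft (fun v => -Complex.I * v * g v) x =
      (1 / (2 * Real.pi) : ℝ) • ft (fun v : ℝ => (-2 * Real.pi * Complex.I * v : ℂ) • g v) x := by
    rw [Complex.real_smul, ← ft_const_mul]
    congr 1
    ext v
    push_cast
    rw [smul_eq_mul]
    field_simp
  rw [e]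
  exact h3

lemma tendsto_ft_atBot (g : ℝ → ℂ) : Filter.Tendsto (ft g) Filter.atBot (nhds 0) := by
  have h := (Real.zero_at_infty_fourier g).mono_left
    (atBot_le_cocompact : Filter.atBot ≤ Filter.cocompact ℝ)
  exact h.comp (Filter.tendsto_id.atBot_div_const (by positivity))

/-- Since `-iv` times the high symbol is the high frequency part of the full symbol, the density of
the high symbol is an antiderivative of that part. By Riemann–Lebesgue it vanishes at `-∞`, so it is
the primitive. -/
lemma primitive_density_eq {p : ℝ} (hp : 1 ≤ p) {k : ℝ → ℝ} (hk : IsKernel p k) {r : ℝ → ℂ}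
    (hr : ContDiff ℝ 1 r) {h : ℝ} (hh : 0 < h) (x : ℝ) :
    primitive (density (symbol k r h)) x =
      primitive (density (lowSymbol k r h)) x + density (highSymbol k r h) x := by
  have hp1 : 1 ≤ ⌈p⌉₊ := Nat.one_le_ceil_iff.2 (by linarith)
  have hr' : ContDiff ℝ (1 : ℕ) r := by exact_mod_cast hr
  set G := highSymbol k r h with hG
  have hGd : ContDiff ℝ 1 G := by exact_mod_cast contDiff_highSymbol hk hp1 hr' h
  have hGs : ∀ v, 1 / h < |v| → G v = 0 := fun v hv => by
    simp [hG, highSymbol, scaledStar_eq_zero hk hh hv]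
  have hGc := hasCompactSupport_of_eq_zero_outside hGs
  set H : ℝ → ℂ := fun v => -Complex.I * v * G v with hH
  have hHd : ContDiff ℝ 1 H :=
    (contDiff_const.mul Complex.ofRealCLM.contDiff).mul hGd
  have hHc : HasCompactSupport H :=
    hasCompactSupport_of_eq_zero_outside (a := 1 / h) fun v hv => by simp [hH, hGs v hv]
  have hld : ContDiff ℝ 1 (lowSymbol k r h) := by
    exact_mod_cast contDiff_lowSymbol hk hp1 hr' h
  have hlc : HasCompactSupport (lowSymbol k r h) :=
    hasCompactSupport_of_eq_zero_outside fun v hv => lowSymbol_eq_zero k r h hv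
  have hsplit : ∀ u, density (symbol k r h) u = density (lowSymbol k r h) u + density H u := by
    intro u
    have e : (lowSymbol k r h) = fun v => symbol k r h v - H v := by
      ext v
      have := neg_I_mul_highCut v
      simp only [hH, hG, highSymbol, lowSymbol, symbol]
      linear_combination (scaledStar k h v * r v) * this
    have h1 := ft_sub ((contDiff_symbol hp hk hr h).continuous.integrable_of_hasCompactSupport
      (hasCompactSupport_symbol hk r hh)) (hHd.continuous.integrable_of_hasCompactSupport hHc) u
    rw [← e] at h1
    simp only [density]
    rw [h1, mul_sub, Complex.sub_re]
    ring
  have hHi := integrable_density hHd hHc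
  have hprim : ∫ u in Iic x, density H u = density G x := by
    have hd : ∀ u, HasDerivAt (density G) (density H u) u := fun u => by
      have h1 := (hasDerivAt_ft hGd.continuous hGc u).const_mul (1 / (2 * (Real.pi : ℂ)))
      exact Complex.reCLM.hasFDerivAt.comp_hasDerivAt u h1
    have ht : Filter.Tendsto (density G) Filter.atBot (nhds 0) := by
      have h1 := (tendsto_ft_atBot G).const_mul (1 / (2 * (Real.pi : ℂ)))
      rw [mul_zero] at h1
      exact (Complex.continuous_re.tendsto 0).comp h1
    have h2 := integral_Iic_of_hasDerivAt_of_tendsto (a := x)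
      (hd x).continuousAt.continuousWithinAt (fun u _ => hd u) hHi.integrableOn ht
    simpa using h2
  simp only [primitive, hsplit]
  rw [integral_add (integrable_density hld hlc).integrableOn hHi.integrableOn, hprim]

/-! ### The low frequency part -/

/-- The difference is, up to sign, the integral of `a` over the half-line below `x - y` if `x < 0`,
and above it otherwise. If `|y| < |x|/2` that half-line lies in `|u| ≥ |x|/2`; if not, the total
mass is a sufficient bound. -/
lemma abs_primitive_sub_le {a : ℝ → ℝ} (ha : Integrable a) (x y : ℝ) :
    ENNReal.ofReal |primitive a (x - y) - if x < 0 then 0 else ∫ u, a u| ≤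
      (∫⁻ u in {u | |x| / 2 ≤ |u|}, ‖a u‖ₑ) +
        {y | |x| / 2 ≤ |y|}.indicator (fun _ => ∫⁻ u, ‖a u‖ₑ) y := by
  have hset : ∃ s : Set ℝ, MeasurableSet s ∧
      |primitive a (x - y) - if x < 0 then 0 else ∫ u, a u| = |∫ u in s, a u| ∧
      (|y| < |x| / 2 → s ⊆ {u | |x| / 2 ≤ |u|}) := by
    by_cases hx : x < 0
    · refine ⟨Iic (x - y), measurableSet_Iic, by simp [hx, primitive], fun hy u hu => ?_⟩
      rw [abs_of_neg hx] at hy ⊢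
      have h1 := (abs_lt.1 hy).1
      simp only [mem_Iic, mem_ofPred_eq] at hu ⊢
      rw [abs_of_neg (by linarith)]
      linarith
    · refine ⟨Ioi (x - y), measurableSet_Ioi, ?_, fun hy u hu => ?_⟩
      · have h := intervalIntegral.integral_Iic_add_Ioi (b := x - y) (f := a) (μ := volume)
          ha.integrableOn ha.integrableOn
        rw [if_neg hx, ← h, primitive, sub_add_cancel_left, abs_neg]
      · rw [abs_of_nonneg (not_lt.1 hx)] at hy ⊢
        have h1 := (abs_lt.1 hy).2
        simp only [mem_Ioi, mem_ofPred_eq] at hu ⊢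
        rw [abs_of_nonneg (by linarith [not_lt.1 hx])]
        linarith
  obtain ⟨s, hs, he, hsub⟩ := hset
  have hle : ENNReal.ofReal |∫ u in s, a u| ≤ ∫⁻ u in s, ‖a u‖ₑ := by
    rw [← Real.norm_eq_abs, ofReal_norm]
    exact enorm_integral_le_lintegral_enorm _
  rw [he]
  refine hle.trans ?_
  by_cases hy : |x| / 2 ≤ |y|
  · rw [indicator_of_mem (by exact hy)]
    exact (setLIntegral_le_lintegral _ _).trans le_add_self
  · exact (lintegral_mono_set (hsub (not_le.1 hy))).trans le_self_add

lemma lintegral_sq_primitive_sub_le {a : ℝ → ℝ} (ha : Integrable a) (ν : Measure ℝ)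
    [IsProbabilityMeasure ν] (x : ℝ) :
    (∫⁻ y, ENNReal.ofReal ((primitive a (x - y) - if x < 0 then 0 else ∫ u, a u) ^ 2) ∂ν) ^
        (1 / 2 : ℝ) ≤
      2 * ((∫⁻ u in {u | |x| / 2 ≤ |u|}, ‖a u‖ₑ) +
        (∫⁻ u, ‖a u‖ₑ) * ν {y | |x| / 2 ≤ |y|} ^ (1 / 2 : ℝ)) := by
  set T := ∫⁻ u in {u | |x| / 2 ≤ |u|}, ‖a u‖ₑ
  set N := ∫⁻ u, ‖a u‖ₑ
  have hm : MeasurableSet {y : ℝ | |x| / 2 ≤ |y|} := measurableSet_le (by fun_prop) (by fun_prop)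
  -- The constant `2` of `(s + t)² ≤ 2(s² + t²)` is enlarged to `4`, whose square root is `2`.
  have h1 : ∫⁻ y, ENNReal.ofReal ((primitive a (x - y) - if x < 0 then 0 else ∫ u, a u) ^ 2) ∂ν ≤
      4 * (T ^ 2 + N ^ 2 * ν {y | |x| / 2 ≤ |y|}) := by
    calc _ ≤ ∫⁻ y, 4 * (T ^ 2 + {y | |x| / 2 ≤ |y|}.indicator (fun _ => N ^ 2) y) ∂ν := by
          refine lintegral_mono fun y => ?_
          rw [← sq_abs, ENNReal.ofReal_pow (abs_nonneg _)]
          refine (pow_le_pow_left' (abs_primitive_sub_le ha x y) 2).trans ?_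
          by_cases hy : y ∈ {y | |x| / 2 ≤ |y|}
          · rw [indicator_of_mem hy, indicator_of_mem hy]
            have h := ENNReal.rpow_add_le_mul_rpow_add_rpow T N (p := 2) (by norm_num)
            norm_num at h
            refine h.trans ?_
            gcongr
            norm_num
          · rw [indicator_of_notMem hy, indicator_of_notMem hy, add_zero, add_zero]
            exact le_mul_of_one_le_left zero_le (by norm_num)
      _ = _ := by
          rw [lintegral_const_mul' _ _ (by norm_num), lintegral_add_left measurable_const,
            lintegral_const, measure_univ, mul_one, lintegral_indicator hm, setLIntegral_const]
  calc _ ≤ (4 * (T ^ 2 + N ^ 2 * ν {y | |x| / 2 ≤ |y|})) ^ (1 / 2 : ℝ) := by gcongr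
    _ ≤ 2 * ((T ^ 2) ^ (1 / 2 : ℝ) + (N ^ 2 * ν {y | |x| / 2 ≤ |y|}) ^ (1 / 2 : ℝ)) := by
        rw [ENNReal.mul_rpow_of_nonneg _ _ (by norm_num)]
        have e : (4 : ℝ≥0∞) ^ (1 / 2 : ℝ) = 2 := by
          rw [show (4 : ℝ≥0∞) = 2 ^ 2 by norm_num, sq_rpow_half]
        rw [e]
        gcongr
        exact ENNReal.rpow_add_le_add_rpow _ _ (by norm_num) (by norm_num)
    _ = _ := by
        rw [sq_rpow_half, ENNReal.mul_rpow_of_nonneg _ _ (by norm_num), sq_rpow_half]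

lemma lintegral_even (f : ℝ → ℝ≥0∞) (hf : Measurable f) :
    ∫⁻ x, f |x| = 2 * ∫⁻ x in Ioi (0 : ℝ), f x := by
  have h1 : ∫⁻ x in Ioi (0 : ℝ), f |x| = ∫⁻ x in Ioi (0 : ℝ), f x :=
    setLIntegral_congr_fun measurableSet_Ioi fun x hx => by rw [abs_of_pos hx]
  have h2 : ∫⁻ x in Iic (0 : ℝ), f |x| = ∫⁻ x in Ioi (0 : ℝ), f x := by
    have h := (Measure.measurePreserving_neg (volume : Measure ℝ)).setLIntegral_comp_preimage
      (s := Ici (0 : ℝ)) measurableSet_Ici (f := fun x => f |x|) (by fun_prop)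
    simp only [abs_neg, neg_preimage, Set.neg_Ici, neg_zero] at h
    rw [h, setLIntegral_congr Ioi_ae_eq_Ici.symm, h1]
  rw [← lintegral_add_compl _ (measurableSet_Iic (a := (0 : ℝ))), compl_Iic, h1, h2, two_mul]

lemma lintegral_rpow_mul_comp_half {p : ℝ} (φ : ℝ → ℝ≥0∞) :
    ∫⁻ x, ENNReal.ofReal (|x| ^ (p - 1)) * φ (|x| / 2) =
      ENNReal.ofReal (2 ^ p) * ∫⁻ x, ENNReal.ofReal (|x| ^ (p - 1)) * φ |x| := by
  have h := lintegral_comp_div (fun z => ENNReal.ofReal (|2 * z| ^ (p - 1)) * φ |z|)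
    (c := 2) (by norm_num)
  have e : ∀ x : ℝ, ENNReal.ofReal (|2 * (x / 2)| ^ (p - 1)) * φ |x / 2| =
      ENNReal.ofReal (|x| ^ (p - 1)) * φ (|x| / 2) := by
    intro x
    rw [mul_div_cancel₀ _ (by norm_num : (2 : ℝ) ≠ 0), abs_div, abs_two]
  simp only [e] at h
  rw [h]
  have e2 : ∀ x : ℝ, ENNReal.ofReal (|2 * x| ^ (p - 1)) * φ |x| =
      ENNReal.ofReal (2 ^ (p - 1)) * (ENNReal.ofReal (|x| ^ (p - 1)) * φ |x|) := by
    intro x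
    rw [abs_mul, abs_two, Real.mul_rpow (by norm_num) (abs_nonneg x),
      ENNReal.ofReal_mul (by positivity), mul_assoc]
  simp only [e2]
  rw [lintegral_const_mul' _ _ ENNReal.ofReal_ne_top, ← mul_assoc, ← ENNReal.ofReal_mul (by norm_num)]
  congr 2
  rw [mul_comm, ← Real.rpow_add_one (by norm_num), sub_add_cancel]

/-- By Tonelli the weight attached to `u` is the integral of `|x|^(p-1)` over `|x| ≤ |u|`, namely
`2|u|^p / p`, and `p ≥ 1`. -/
lemma lintegral_rpow_mul_tail_le {p : ℝ} (hp : 1 ≤ p) {a : ℝ → ℝ} (ha : Continuous a) :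
    ∫⁻ x, ENNReal.ofReal (|x| ^ (p - 1)) * ∫⁻ u in {u | |x| ≤ |u|}, ‖a u‖ₑ ≤
      2 * ∫⁻ u, ENNReal.ofReal (|u| ^ p) * ‖a u‖ₑ := by
  have hm : MeasurableSet {z : ℝ × ℝ | |z.1| ≤ |z.2|} :=
    measurableSet_le (by fun_prop) (by fun_prop)
  have hm2 : ∀ x : ℝ, MeasurableSet {u : ℝ | |x| ≤ |u|} := fun x =>
    measurableSet_le (by fun_prop) (by fun_prop)
  have hmf : Measurable fun z : ℝ × ℝ => {z : ℝ × ℝ | |z.1| ≤ |z.2|}.indicator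
      (fun z => ENNReal.ofReal (|z.1| ^ (p - 1)) * ‖a z.2‖ₑ) z := by
    refine Measurable.indicator ?_ hm
    have := ha.measurable
    fun_prop
  calc _ = ∫⁻ x, ∫⁻ u, {z : ℝ × ℝ | |z.1| ≤ |z.2|}.indicator
        (fun z => ENNReal.ofReal (|z.1| ^ (p - 1)) * ‖a z.2‖ₑ) (x, u) := by
        refine lintegral_congr fun x => ?_
        rw [← lintegral_indicator (hm2 x), ← lintegral_const_mul' _ _ ENNReal.ofReal_ne_top]
        refine lintegral_congr fun u => ?_
        simp only [indicator, mem_ofPred_eq, mul_ite, mul_zero]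
    _ = ∫⁻ u, ∫⁻ x, {z : ℝ × ℝ | |z.1| ≤ |z.2|}.indicator
        (fun z => ENNReal.ofReal (|z.1| ^ (p - 1)) * ‖a z.2‖ₑ) (x, u) :=
        lintegral_lintegral_swap hmf.aemeasurable
    _ ≤ ∫⁻ u, 2 * (ENNReal.ofReal (|u| ^ p) * ‖a u‖ₑ) := by
        refine lintegral_mono fun u => ?_
        have e : ∀ x : ℝ, {z : ℝ × ℝ | |z.1| ≤ |z.2|}.indicator
            (fun z => ENNReal.ofReal (|z.1| ^ (p - 1)) * ‖a z.2‖ₑ) (x, u) =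
            (Icc (-|u|) |u|).indicator (fun x => ENNReal.ofReal (|x| ^ (p - 1))) x * ‖a u‖ₑ := by
          intro x
          simp only [indicator, mem_ofPred_eq, mem_Icc, ← abs_le, ite_mul, zero_mul]
        simp only [e]
        rw [lintegral_mul_const' _ _ enorm_ne_top, ← mul_assoc]
        gcongr
        rw [lintegral_indicator measurableSet_Icc, ← setLIntegral_congr Ioc_ae_eq_Icc,
          ← Ioc_union_Ioc_eq_Ioc (b := 0) (by simp) (by simp), lintegral_union measurableSet_Ioc
          (Ioc_disjoint_Ioc_of_le le_rfl), lintegral_Ioc_neg_rpow (p - 1) (-|u|) 0, neg_zero,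
          neg_neg, lintegral_Ioc_rpow hp le_rfl (abs_nonneg u),
          Real.zero_rpow (by linarith), sub_zero, two_mul]
        have : |u| ^ p / p ≤ |u| ^ p := div_le_self (by positivity) hp
        gcongr
    _ = _ := lintegral_const_mul' _ _ (by norm_num)

/-- The weighted deviation of the low frequency part. -/
lemma lintegral_low_le {p : ℝ} (hp : 1 ≤ p) {a : ℝ → ℝ} (hac : Continuous a) (ha : Integrable a)
    (ν : Measure ℝ) [IsProbabilityMeasure ν] :
    ∫⁻ x, ENNReal.ofReal (|x| ^ (p - 1)) *
      (∫⁻ y, ENNReal.ofReal ((primitive a (x - y) - if x < 0 then 0 else ∫ u, a u) ^ 2) ∂ν) ^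
        (1 / 2 : ℝ) ≤
    ENNReal.ofReal (4 * 2 ^ p) * ((∫⁻ u, ENNReal.ofReal (|u| ^ p) * ‖a u‖ₑ) +
      (∫⁻ u, ‖a u‖ₑ) * ∫⁻ x in Ioi (0 : ℝ),
        ENNReal.ofReal (|x| ^ (p - 1)) * ν {y | x ≤ |y|} ^ (1 / 2 : ℝ)) := by
  set N := ∫⁻ u, ‖a u‖ₑ
  have hNt : N ≠ ∞ := ha.2.ne
  have hν : Measurable fun c : ℝ => ν {y | c ≤ |y|} ^ (1 / 2 : ℝ) := by
    refine Measurable.pow_const (Antitone.measurable fun c d hcd => measure_mono ?_) _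
    exact fun y hy => hcd.trans hy
  have hT : Measurable fun c : ℝ => ∫⁻ u in {u | c ≤ |u|}, ‖a u‖ₑ :=
    Antitone.measurable fun c d hcd => lintegral_mono_set fun y hy => hcd.trans hy
  calc _ ≤ ∫⁻ x, 2 * (ENNReal.ofReal (|x| ^ (p - 1)) * (∫⁻ u in {u | |x| / 2 ≤ |u|}, ‖a u‖ₑ) +
        N * (ENNReal.ofReal (|x| ^ (p - 1)) * ν {y | |x| / 2 ≤ |y|} ^ (1 / 2 : ℝ))) := by
        refine lintegral_mono fun x => ?_
        refine (mul_le_mul_right (lintegral_sq_primitive_sub_le ha ν x) _).trans (le_of_eq ?_)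
        ring
    _ = 2 * ((∫⁻ x, ENNReal.ofReal (|x| ^ (p - 1)) * ∫⁻ u in {u | |x| / 2 ≤ |u|}, ‖a u‖ₑ) +
        N * ∫⁻ x, ENNReal.ofReal (|x| ^ (p - 1)) * ν {y | |x| / 2 ≤ |y|} ^ (1 / 2 : ℝ)) := by
        rw [lintegral_const_mul' _ _ (by norm_num), lintegral_add_left, lintegral_const_mul' _ _ hNt]
        exact Measurable.mul (by fun_prop) (hT.comp (by fun_prop))
    _ ≤ 2 * (ENNReal.ofReal (2 ^ p) * (2 * ∫⁻ u, ENNReal.ofReal (|u| ^ p) * ‖a u‖ₑ) +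
        N * (ENNReal.ofReal (2 ^ p) * (2 * ∫⁻ x in Ioi (0 : ℝ),
          ENNReal.ofReal (|x| ^ (p - 1)) * ν {y | x ≤ |y|} ^ (1 / 2 : ℝ)))) := by
        rw [lintegral_rpow_mul_comp_half fun c => ∫⁻ u in {u | c ≤ |u|}, ‖a u‖ₑ,
          lintegral_rpow_mul_comp_half fun c => ν {y | c ≤ |y|} ^ (1 / 2 : ℝ)]
        gcongr
        · exact lintegral_rpow_mul_tail_le hp hac
        · have := lintegral_even (fun x => ENNReal.ofReal (|x| ^ (p - 1)) *
            ν {y | x ≤ |y|} ^ (1 / 2 : ℝ)) (Measurable.mul (by fun_prop) hν)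
          simp only [abs_abs] at this
          rw [this]
    _ = _ := by
        rw [ENNReal.ofReal_mul (by norm_num), ENNReal.ofReal_ofNat]
        ring

/-! ### The high frequency part -/

/-- The left base is at most three times the largest of `1`, `|y|`, `|z|`. When that maximum is at
least `1`, raising the exponent from `s` only increases its power. -/
lemma one_add_abs_rpow_le {s a : ℝ} {m : ℕ} (hs : 0 ≤ s) (hsa : s ≤ a) (hsm : s ≤ 2 * m)
    (y z : ℝ) :
    (1 + |z + y|) ^ s ≤ 3 ^ s * (1 + |y| ^ a + |z| ^ (2 * m)) := by
  have key : ∀ t : ℝ, 1 ≤ t → 1 + |z + y| ≤ 3 * t → t ^ s ≤ 1 + |y| ^ a + |z| ^ (2 * m) →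
      (1 + |z + y|) ^ s ≤ 3 ^ s * (1 + |y| ^ a + |z| ^ (2 * m)) := by
    intro t ht h1 h2
    calc (1 + |z + y|) ^ s ≤ (3 * t) ^ s := by gcongr
      _ = 3 ^ s * t ^ s := Real.mul_rpow (by norm_num) (by linarith)
      _ ≤ _ := by gcongr
  have hzy := abs_add_le z y
  have hy0 : 0 ≤ |y| ^ a := by positivity
  have hz0 : 0 ≤ |z| ^ (2 * m) := by positivity
  by_cases h1 : |y| ≤ 1 ∧ |z| ≤ 1
  · refine key 1 le_rfl (by linarith [h1.1, h1.2]) ?_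
    rw [Real.one_rpow]
    linarith
  · rcases le_total |y| |z| with h2 | h2
    · have hz1 : 1 ≤ |z| := by
        by_contra h
        exact h1 ⟨by linarith, by linarith⟩
      refine key |z| hz1 (by linarith) ?_
      have : |z| ^ s ≤ |z| ^ (2 * m) := by
        rw [← Real.rpow_natCast]
        exact Real.rpow_le_rpow_of_exponent_le hz1 (by push_cast; exact hsm)
      linarith
    · have hy1 : 1 ≤ |y| := by
        by_contra h
        exact h1 ⟨by linarith, by linarith⟩
      refine key |y| hy1 (by linarith) ?_
      have : |y| ^ s ≤ |y| ^ a := Real.rpow_le_rpow_of_exponent_le hy1 hsa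
      linarith

/-- The weighted deviation of the high frequency part. -/
lemma exists_lintegral_high_le {p : ℝ} (hp : 1 ≤ p) {m : ℕ} (hm : p - 1 / 2 < m) :
    ∃ C : ℝ≥0, ∀ (f : ℝ → ℝ) (ν : Measure ℝ), Measurable f → IsProbabilityMeasure ν →
      ∫⁻ x, ENNReal.ofReal (|x| ^ (p - 1)) *
        (∫⁻ y, ENNReal.ofReal ((f (x - y) - 0) ^ 2) ∂ν) ^ (1 / 2 : ℝ) ≤
      C * ((1 + ∫⁻ y, ENNReal.ofReal (|y| ^ (2 * p - 1 / 2)) ∂ν) * (∫⁻ z, ‖f z‖ₑ ^ 2) +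
        ∫⁻ z, ENNReal.ofReal (|z| ^ (2 * m)) * ‖f z‖ₑ ^ 2) ^ (1 / 2 : ℝ) := by
  -- The exponent must exceed `2(p - 1) + 1` for Cauchy–Schwarz, stay below `2m` to be covered by
  -- `m` derivatives, and below `2p - 1/2` to use only the moment in `A₃`. The condition `p - 1/2 <
  -- m` leaves room for this.
  set s : ℝ := min (2 * m) (2 * p - 1 / 2) with hs
  have hs1 : 2 * (p - 1) + 1 < s := by
    rw [hs, lt_min_iff]
    constructor <;> linarith
  have hs0 : 0 ≤ s := by linarith
  obtain ⟨C, hC⟩ := exists_lintegral_rpow_mul_le (q := p - 1) (by linarith) hs1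
  refine ⟨C * ((ENNReal.ofReal (3 ^ s)) ^ (1 / 2 : ℝ)).toNNReal, fun f ν hf hν => ?_⟩
  have hmeas : Measurable fun x => ∫⁻ y, ENNReal.ofReal ((f (x - y) - 0) ^ 2) ∂ν := by
    refine Measurable.lintegral_prod_right'
      (f := fun z : ℝ × ℝ => ENNReal.ofReal ((f (z.1 - z.2) - 0) ^ 2)) ?_
    fun_prop
  refine (hC _ (hmeas.pow_const _)).trans ?_
  push_cast
  rw [ENNReal.coe_toNNReal (ENNReal.rpow_ne_top_of_nonneg (by norm_num) ENNReal.ofReal_ne_top),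
    mul_assoc, ← ENNReal.mul_rpow_of_nonneg _ _ (by norm_num)]
  gcongr
  have e2 : ∀ t : ℝ≥0∞, (t ^ (1 / 2 : ℝ)) ^ 2 = t := fun t => by
    rw [← ENNReal.rpow_natCast, ← ENNReal.rpow_mul]; norm_num
  simp only [e2, sub_zero]
  set J := ∫⁻ y, ENNReal.ofReal (|y| ^ (2 * p - 1 / 2)) ∂ν
  set I₀ := ∫⁻ z, ‖f z‖ₑ ^ 2
  set I₁ := ∫⁻ z, ENNReal.ofReal (|z| ^ (2 * m)) * ‖f z‖ₑ ^ 2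
  calc ∫⁻ x, ENNReal.ofReal ((1 + |x|) ^ s) * ∫⁻ y, ENNReal.ofReal (f (x - y) ^ 2) ∂ν
      = ∫⁻ x, ∫⁻ y, ENNReal.ofReal ((1 + |x|) ^ s) * ‖f (x - y)‖ₑ ^ 2 ∂ν := by
        refine lintegral_congr fun x => ?_
        rw [← lintegral_const_mul' _ _ ENNReal.ofReal_ne_top]
        refine lintegral_congr fun y => ?_
        rw [← ofReal_norm, ← ENNReal.ofReal_pow (norm_nonneg _), Real.norm_eq_abs, sq_abs]
    _ = ∫⁻ y, (∫⁻ x, ENNReal.ofReal ((1 + |x|) ^ s) * ‖f (x - y)‖ₑ ^ 2) ∂ν :=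
        lintegral_lintegral_swap (by fun_prop)
    _ = ∫⁻ y, (∫⁻ z, ENNReal.ofReal ((1 + |z + y|) ^ s) * ‖f z‖ₑ ^ 2) ∂ν := by
        refine lintegral_congr fun y => ?_
        rw [← lintegral_add_right_eq_self (fun x => ENNReal.ofReal ((1 + |x|) ^ s) *
          ‖f (x - y)‖ₑ ^ 2) y]
        simp
    _ ≤ ∫⁻ y, (∫⁻ z, ENNReal.ofReal (3 ^ s) *
          ((1 + ENNReal.ofReal (|y| ^ (2 * p - 1 / 2))) * ‖f z‖ₑ ^ 2 +
            ENNReal.ofReal (|z| ^ (2 * m)) * ‖f z‖ₑ ^ 2)) ∂ν := by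
        refine lintegral_mono fun y => lintegral_mono fun z => ?_
        rw [← add_mul, ← mul_assoc]
        gcongr
        rw [← ENNReal.ofReal_one, ← ENNReal.ofReal_add (by norm_num) (by positivity),
          ← ENNReal.ofReal_add (by positivity) (by positivity),
          ← ENNReal.ofReal_mul (by positivity)]
        exact ENNReal.ofReal_le_ofReal
          (one_add_abs_rpow_le hs0 (min_le_right _ _) (min_le_left _ _) y z)
    _ = ∫⁻ y, ENNReal.ofReal (3 ^ s) *
          ((1 + ENNReal.ofReal (|y| ^ (2 * p - 1 / 2))) * I₀ + I₁) ∂ν := by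
        refine lintegral_congr fun y => ?_
        rw [lintegral_const_mul' _ _ ENNReal.ofReal_ne_top, lintegral_add_left (by fun_prop),
          lintegral_const_mul' _ _ (by simp)]
    _ = ENNReal.ofReal (3 ^ s) * ((1 + J) * I₀ + I₁) := by
        rw [lintegral_const_mul' _ _ ENNReal.ofReal_ne_top,
          lintegral_add_left (by fun_prop), lintegral_mul_const _ (by fun_prop),
          lintegral_add_left measurable_const]
        simp [J]

/-! ### Proof of the risk bound -/

lemma leastGt_add_half {p : ℝ} (hp : 1 ≤ p) :
    leastGt (p + 1 / 2) = leastGt (p - 1 / 2) + 1 := by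
  rw [leastGt, leastGt, show p + 1 / 2 = p - 1 / 2 + 1 by ring,
    Nat.floor_add_one (by linarith)]

/-- So `k^*` has the `m₁` derivatives that the high part uses; the low part uses `m₀ = m₁ + 1`, the
last one through the Lipschitz condition. -/
lemma leastGt_sub_half_le {p : ℝ} (hp : 1 ≤ p) : leastGt (p - 1 / 2) ≤ ⌈p⌉₊ := by
  rw [leastGt, Nat.add_one_le_iff, Nat.lt_ceil]
  have := Nat.floor_le (show (0 : ℝ) ≤ p - 1 / 2 by linarith)
  linarith

lemma lt_leastGt (x : ℝ) : x < leastGt x := by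
  rw [leastGt]
  exact_mod_cast Nat.lt_floor_add_one x

lemma supDeriv_ne_top {r : ℝ → ℂ} {m : ℕ} (hr : ContDiff ℝ m r) : supDeriv r m ≠ ∞ := by
  have hc : Continuous fun t => ∑ l ∈ Finset.range (m + 1), ‖iteratedDeriv l r t‖ :=
    continuous_finsetSum _ fun l hl => (hr.continuous_iteratedDeriv l
      (by exact_mod_cast Nat.lt_succ_iff.1 (Finset.mem_range.1 hl))).norm
  obtain ⟨C, hC⟩ := (isCompact_Icc (a := (-2 : ℝ)) (b := 2)).exists_bound_of_continuousOn
    hc.continuousOn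
  refine ne_top_of_le_ne_top (ENNReal.ofReal_ne_top (r := C)) (iSup₂_le fun t ht => ?_)
  rw [← ENNReal.ofReal_sum_of_nonneg fun _ _ => norm_nonneg _]
  exact ENNReal.ofReal_le_ofReal ((le_abs_self _).trans (hC t ht))

lemma norm_iteratedDeriv_le_supDeriv {r : ℝ → ℂ} {m : ℕ} (hr : ContDiff ℝ m r) {t : ℝ}
    (ht : t ∈ Icc (-2 : ℝ) 2) {l : ℕ} (hl : l ≤ m) :
    ‖iteratedDeriv l r t‖ ≤ ((supDeriv r m).toNNReal : ℝ) := by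
  have h1 : ENNReal.ofReal ‖iteratedDeriv l r t‖ ≤ supDeriv r m :=
    (Finset.single_le_sum (f := fun l => ENNReal.ofReal ‖iteratedDeriv l r t‖)
      (fun _ _ => zero_le) (Finset.mem_range.2 (by omega))).trans
      (le_iSup₂ (f := fun t (_ : t ∈ Icc (-2 : ℝ) 2) =>
        ∑ l ∈ Finset.range (m + 1), ENNReal.ofReal ‖iteratedDeriv l r t‖) t ht)
  exact (ENNReal.ofReal_le_iff_le_toReal (supDeriv_ne_top hr)).1 h1

/-- A characteristic function equals `1` at the origin. This lower bound on `A₂` is what absorbs the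
optimisation error `ρ`. -/
lemma one_le_supDeriv_recipChar (με : Measure ℝ) [IsProbabilityMeasure με] (m : ℕ) :
    1 ≤ supDeriv (recipChar με) m := by
  have h : (1 : ℝ≥0∞) = ENNReal.ofReal ‖iteratedDeriv 0 (recipChar με) 0‖ := by
    simp [recipChar]
  rw [h]
  exact (Finset.single_le_sum (f := fun l => ENNReal.ofReal ‖iteratedDeriv l (recipChar με) 0‖)
    (fun _ _ => zero_le) (Finset.mem_range.2 (Nat.succ_pos m))).trans
    (le_iSup₂ (f := fun t (_ : t ∈ Icc (-2 : ℝ) 2) => ∑ l ∈ Finset.range (m + 1),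
      ENNReal.ofReal ‖iteratedDeriv l (recipChar με) t‖) 0 (by norm_num))

lemma enorm_density_le (g : ℝ → ℂ) (x : ℝ) : ‖density g x‖ₑ ≤ ‖ft g x‖ₑ := by
  rw [← ofReal_norm, ← ofReal_norm]
  exact ENNReal.ofReal_le_ofReal (abs_density_le g x)

/-- The `L¹` norm of the low density needs one derivative of `r`, and multiplies the tail integral
of `Y`: this is `A₁`. Its `p`-th absolute moment needs `m₀` derivatives and does not involve `Y`:
this is `A₂`. -/
lemma exists_low_le {p : ℝ} (hp : 1 ≤ p) {k : ℝ → ℝ} (hk : IsKernel p k) :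
    ∃ C : ℝ≥0, ∀ (h : ℝ) (r : ℝ → ℂ) (ν : Measure ℝ), 0 < h → h ≤ 1 →
      ContDiff ℝ (leastGt (p + 1 / 2) : ℕ) r → IsProbabilityMeasure ν →
      ∫⁻ x, ENNReal.ofReal (|x| ^ (p - 1)) * (∫⁻ y, ENNReal.ofReal
        ((primitive (density (lowSymbol k r h)) (x - y) -
          if x < 0 then 0 else ∫ u, density (lowSymbol k r h) u) ^ 2) ∂ν) ^ (1 / 2 : ℝ) ≤
      C * (termA1 p r ν + termA2 p r) := by
  have hm := leastGt_sub_half_le hp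
  obtain ⟨C₁, hC₁⟩ := exists_lintegral_ft_lowSymbol_le hp hk
  obtain ⟨C₂, hC₂⟩ := exists_lintegral_rpow_mul_ft_lowSymbol_le hp hk hm
    (by linarith [lt_leastGt (p - 1 / 2)])
  refine ⟨Real.toNNReal (4 * 2 ^ p) * (C₁ + C₂), fun h r ν hh hh1 hr hν => ?_⟩
  have hr1 : ContDiff ℝ 1 r := hr.of_le (by
    rw [leastGt]; exact_mod_cast Nat.succ_le_succ (Nat.zero_le _))
  have hr1' : ContDiff ℝ (1 : ℕ) r := by exact_mod_cast hr1
  have hp1 : 1 ≤ ⌈p⌉₊ := Nat.one_le_ceil_iff.2 (by linarith)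
  have hld : ContDiff ℝ 1 (lowSymbol k r h) := by
    exact_mod_cast contDiff_lowSymbol hk hp1 hr1' h
  have hlc : HasCompactSupport (lowSymbol k r h) :=
    hasCompactSupport_of_eq_zero_outside fun v hv => lowSymbol_eq_zero k r h hv
  have h1 := lintegral_low_le hp (continuous_density
    (hld.continuous.integrable_of_hasCompactSupport hlc)) (integrable_density hld hlc) ν
  have h2 := hC₁ h r _ hh hh1 hr1 fun t ht l hl => norm_iteratedDeriv_le_supDeriv hr1' ht hl
  rw [ENNReal.coe_toNNReal (supDeriv_ne_top hr1')] at h2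
  rw [leastGt_add_half hp] at hr
  have h3 := hC₂ h r _ hh hh1 hr fun t ht l hl => norm_iteratedDeriv_le_supDeriv hr ht hl
  rw [ENNReal.coe_toNNReal (supDeriv_ne_top hr), ← leastGt_add_half hp] at h3
  refine h1.trans ?_
  push_cast
  rw [mul_assoc]
  refine mul_le_mul_right ?_ _
  set I := ∫⁻ x in Ioi (0 : ℝ), ENNReal.ofReal (|x| ^ (p - 1)) * ν {y | x ≤ |y|} ^ (1 / 2 : ℝ)
    with hI
  calc _ ≤ C₂ * supDeriv r (leastGt (p + 1 / 2)) + C₁ * supDeriv r 1 * I := by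
        gcongr
        · refine (lintegral_mono fun u => ?_).trans h3
          gcongr
          exact enorm_density_le _ _
        · exact (lintegral_mono fun u => enorm_density_le _ _).trans h2
    _ = C₂ * termA2 p r + C₁ * termA1 p r ν := by rw [termA1, termA2, mul_assoc]
    _ ≤ (C₁ + C₂) * (termA1 p r ν + termA2 p r) := by
        rw [add_mul, add_comm]
        gcongr
        · exact le_self_add
        · exact le_add_self

/-- The translation by `Y` costs a moment, but only against the unweighted `L²` norm, which involves
no derivative of `r`: this is `A₃`. The weighted norm involves `m₁` derivatives and no moment: this
is `A₄`, which also absorbs the moment-free copy of the unweighted norm. -/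
lemma exists_high_le {p : ℝ} (hp : 1 ≤ p) {k : ℝ → ℝ} (hk : IsKernel p k) :
    ∃ C : ℝ≥0, ∀ (h : ℝ) (r : ℝ → ℂ) (ν : Measure ℝ), 0 < h → h ≤ 1 →
      ContDiff ℝ (leastGt (p + 1 / 2) : ℕ) r → IsProbabilityMeasure ν →
      ∫⁻ x, ENNReal.ofReal (|x| ^ (p - 1)) * (∫⁻ y, ENNReal.ofReal
        ((density (highSymbol k r h) (x - y) - 0) ^ 2) ∂ν) ^ (1 / 2 : ℝ) ≤
      C * (termA3 p r ν h + termA4 p r h) := by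
  have hm := leastGt_sub_half_le hp
  set m := leastGt (p - 1 / 2) with hmdef
  obtain ⟨C₁, hC₁⟩ := exists_lintegral_iteratedDeriv_highSymbol_le hk hm
  obtain ⟨C₂, hC₂⟩ := exists_lintegral_high_le hp (lt_leastGt (p - 1 / 2))
  rw [← hmdef] at hC₂
  set E : ℝ≥0∞ := ENNReal.ofReal (2 * Real.pi) * C₁ * 2 with hEdef
  have hE : E ^ (1 / 2 : ℝ) ≠ ∞ := ENNReal.rpow_ne_top_of_nonneg (by norm_num)
    (ENNReal.mul_ne_top (ENNReal.mul_ne_top ENNReal.ofReal_ne_top ENNReal.coe_ne_top) (by norm_num))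
  refine ⟨C₂ * (E ^ (1 / 2 : ℝ)).toNNReal, fun h r ν hh hh1 hr hν => ?_⟩
  have hrm : ContDiff ℝ m r := hr.of_le (by
    rw [leastGt_add_half hp]; exact_mod_cast Nat.le_succ _)
  set G := highSymbol k r h with hG
  have hGd : ContDiff ℝ m G := contDiff_highSymbol hk hm hrm h
  have hGc : HasCompactSupport G := hasCompactSupport_of_eq_zero_outside (a := 1 / h)
    fun v hv => by simp [hG, highSymbol, scaledStar_eq_zero hk hh hv]
  have hcont := continuous_density (hGd.continuous.integrable_of_hasCompactSupport hGc)
  refine (hC₂ _ ν hcont.measurable hν).trans ?_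
  set O := ∑ j ∈ Finset.range (m + 1), outerIntegral r h j with hO
  set J := ∫⁻ y, ENNReal.ofReal (|y| ^ (2 * p - 1 / 2)) ∂ν with hJ
  have hO0 : outerIntegral r h 0 ≤ O :=
    Finset.single_le_sum (f := fun j => outerIntegral r h j) (fun _ _ => zero_le)
      (Finset.mem_range.2 (Nat.succ_pos m))
  have h0 : ∫⁻ z, ‖density G z‖ₑ ^ 2 ≤
      ENNReal.ofReal (2 * Real.pi) * (C₁ * outerIntegral r h 0) := by
    calc _ ≤ ∫⁻ z, ‖ft G z‖ₑ ^ 2 := by gcongr with z; exact enorm_density_le _ _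
      _ ≤ _ := by
        rw [lintegral_enorm_sq_ft hGd.continuous hGc]
        gcongr
        simpa using hC₁ h r hh hh1 hrm 0 (Nat.zero_le _)
  have h1 : ∫⁻ z, ENNReal.ofReal (|z| ^ (2 * m)) * ‖density G z‖ₑ ^ 2 ≤
      ENNReal.ofReal (2 * Real.pi) * (C₁ * O) := by
    calc _ ≤ ∫⁻ z, ENNReal.ofReal (|z| ^ (2 * m)) * ‖ft G z‖ₑ ^ 2 := by
          gcongr with z; exact enorm_density_le _ _
      _ ≤ _ := by
        rw [lintegral_pow_mul_enorm_sq_ft hGd hGc]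
        gcongr
        exact hC₁ h r hh hh1 hrm m le_rfl
  push_cast
  rw [ENNReal.coe_toNNReal hE, mul_assoc]
  gcongr
  calc _ ≤ (E * (J * outerIntegral r h 0 + O)) ^ (1 / 2 : ℝ) := by
        gcongr
        calc _ ≤ (1 + J) * (ENNReal.ofReal (2 * Real.pi) * (C₁ * outerIntegral r h 0)) +
              ENNReal.ofReal (2 * Real.pi) * (C₁ * O) := by gcongr
          _ = ENNReal.ofReal (2 * Real.pi) * C₁ *
              (J * outerIntegral r h 0 + (outerIntegral r h 0 + O)) := by ring
          _ ≤ ENNReal.ofReal (2 * Real.pi) * C₁ *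
              (2 * (J * outerIntegral r h 0) + (O + O)) := by
              refine mul_le_mul_right (add_le_add ?_ (add_le_add hO0 le_rfl)) _
              rw [two_mul]
              exact le_self_add
          _ = _ := by rw [hEdef]; ring
    _ = E ^ (1 / 2 : ℝ) * (J * outerIntegral r h 0 + O) ^ (1 / 2 : ℝ) :=
        ENNReal.mul_rpow_of_nonneg _ _ (by norm_num)
    _ ≤ _ := by
        gcongr
        exact ENNReal.rpow_add_le_add_rpow _ _ (by norm_num) (by norm_num)

/-- The expected weighted distance of the preliminary estimator to its mean. -/
lemma exists_lintegral_weightedDist_le {p : ℝ} (hp : 1 ≤ p) {k : ℝ → ℝ} (hk : IsKernel p k) :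
    ∃ C : ℝ≥0, ∀ (n : ℕ) (_ : 1 ≤ n) (h : ℝ) (_ : 0 < h) (_ : h ≤ 1)
      (μ με : Measure ℝ) [IsProbabilityMeasure μ] [IsProbabilityMeasure με]
      (_ : ∀ t, charFun με t ≠ 0)
      (_ : ContDiff ℝ (leastGt (p + 1 / 2) : ℕ) (recipChar με))
      {Ω : Type*} [MeasurableSpace Ω] (P : Measure Ω) [IsProbabilityMeasure P]
      (Y : Fin n → Ω → ℝ) (_ : ∀ i, HasLaw (Y i) (Measure.conv μ με) P) (_ : iIndepFun Y P),
      ∫⁻ ω, weightedDist p (prelimEstimator k με h (fun i => Y i ω))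
        (cdf (Measure.conv μ (kernelLaw k h))) ∂P ≤
        C * ENNReal.ofReal ((n : ℝ) ^ (-(1 / 2) : ℝ)) *
          (termA1 p (recipChar με) (Measure.conv μ με) + termA2 p (recipChar με)
            + termA3 p (recipChar με) (Measure.conv μ με) h + termA4 p (recipChar με) h) := by
  obtain ⟨C₁, hC₁⟩ := exists_low_le hp hk
  obtain ⟨C₂, hC₂⟩ := exists_high_le hp hk
  refine ⟨C₁ + C₂, ?_⟩
  intro n hn h hh hh1 μ με _ _ hne hr Ω _ P _ Y hY hi
  set r := recipChar με with hrdef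
  set ν := Measure.conv μ με with hν
  have hr1 : ContDiff ℝ 1 r := hr.of_le (by
    rw [leastGt]; exact_mod_cast Nat.succ_le_succ (Nat.zero_le _))
  have hr1' : ContDiff ℝ (1 : ℕ) r := by exact_mod_cast hr1
  have hp1 : 1 ≤ ⌈p⌉₊ := Nat.one_le_ceil_iff.2 (by linarith)
  have hsd := contDiff_symbol hp hk hr1 h
  have hsc := hasCompactSupport_symbol hk r hh
  have hsi := integrable_density hsd hsc
  have hld : ContDiff ℝ 1 (lowSymbol k r h) := by
    exact_mod_cast contDiff_lowSymbol hk hp1 hr1' h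
  have hlc : HasCompactSupport (lowSymbol k r h) :=
    hasCompactSupport_of_eq_zero_outside fun v hv => lowSymbol_eq_zero k r h hv
  have hli := integrable_density hld hlc
  have hGd : ContDiff ℝ 1 (highSymbol k r h) := by
    exact_mod_cast contDiff_highSymbol hk hp1 hr1' h
  have hGc : HasCompactSupport (highSymbol k r h) :=
    hasCompactSupport_of_eq_zero_outside (a := 1 / h)
      fun v hv => by simp [highSymbol, scaledStar_eq_zero hk hh hv]
  set K := primitive (density (symbol k r h)) with hK
  set K₁ := primitive (density (lowSymbol k r h)) with hK₁
  set K₂ := density (highSymbol k r h) with hK₂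
  have hKm : Measurable K := measurable_primitive
    (continuous_density (hsd.continuous.integrable_of_hasCompactSupport hsc))
  have hK₁m : Measurable K₁ := measurable_primitive
    (continuous_density (hld.continuous.integrable_of_hasCompactSupport hlc))
  have hK₂c : Continuous K₂ :=
    continuous_density (hGd.continuous.integrable_of_hasCompactSupport hGc)
  have hKb : ∀ x, |K x| ≤ ∫ u, |density (symbol k r h) u| := abs_primitive_le hsi
  have hK₁b : ∀ x, |K₁ x| ≤ ∫ u, |density (lowSymbol k r h) u| := abs_primitive_le hli
  have hsplit : ∀ x, K x = K₁ x + K₂ x := primitive_density_eq hp hk hr1 hh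
  -- The high part is bounded as a difference of two primitives of integrable functions; the
  -- variance bound asks for bounded functions.
  have hK₂b : ∀ x, |K₂ x| ≤
      (∫ u, |density (symbol k r h) u|) + ∫ u, |density (lowSymbol k r h) u| := by
    intro x
    have e : K₂ x = K x - K₁ x := by rw [hsplit]; ring
    rw [e]
    exact (abs_sub _ _).trans (add_le_add (hKb x) (hK₁b x))
  have hest : ∀ (y : Fin n → ℝ) (x : ℝ),
      prelimEstimator k με h y x = 1 / (n : ℝ) * ∑ j, K (x - y j) :=
    prelimEstimator_eq k με hh hsi
  set M := Measure.conv μ (kernelLaw k h) with hM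
  have hmean : ∀ x, ∫ y, K (x - y) ∂ν = cdf M x :=
    integral_primitive_density_symbol hp hk hh μ με hne hr1
  have hint : ∀ (f : ℝ → ℝ) (b : ℝ), Measurable f → (∀ x, |f x| ≤ b) → ∀ x,
      Integrable (fun y => f (x - y)) ν := fun f b hf hb x =>
    Integrable.of_bound (hf.comp (measurable_const.sub measurable_id)).aestronglyMeasurable b
      (Filter.Eventually.of_forall fun y => hb _)
  set N : ℝ≥0∞ := ENNReal.ofReal ((n : ℝ) ^ (-(1 / 2) : ℝ)) with hN
  have hpt : ∀ x, ∫⁻ ω, ENNReal.ofReal |prelimEstimator k με h (fun i => Y i ω) x - cdf M x| ∂P ≤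
      N * (∫⁻ y, ENNReal.ofReal ((K₁ (x - y) -
          if x < 0 then 0 else ∫ u, density (lowSymbol k r h) u) ^ 2) ∂ν) ^ (1 / 2 : ℝ) +
      N * (∫⁻ y, ENNReal.ofReal ((K₂ (x - y) - 0) ^ 2) ∂ν) ^ (1 / 2 : ℝ) := by
    intro x
    have hm1 : Measurable fun y => K₁ (x - y) := by fun_prop
    have hm2 : Measurable fun y => K₂ (x - y) := by
      have := hK₂c.measurable
      fun_prop
    -- The low part is centred at its limit on the side of `x`, without which its second moment
    -- would not decay as `x → +∞`. The high part tends to `0` at infinity and is centred at `0`.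
    have b1 := lintegral_abs_empirical_sub_le hn hY hi hm1 (fun y => hK₁b (x - y))
      (if x < 0 then 0 else ∫ u, density (lowSymbol k r h) u)
    have b2 := lintegral_abs_empirical_sub_le hn hY hi hm2 (fun y => hK₂b (x - y)) 0
    refine le_trans ?_ (add_le_add b1 b2)
    have hYm : ∀ j, AEMeasurable (Y j) P := fun j => (hY j).aemeasurable
    rw [← lintegral_add_left']
    · refine lintegral_mono fun ω => ?_
      rw [← ENNReal.ofReal_add (abs_nonneg _) (abs_nonneg _)]
      apply ENNReal.ofReal_le_ofReal
      rw [hest, ← hmean x]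
      simp only [hsplit]
      rw [integral_add (hint _ _ hK₁m hK₁b x) (hint _ _ hK₂c.measurable hK₂b x),
        Finset.sum_add_distrib, mul_add, add_sub_add_comm]
      exact abs_add_le _ _
    · have : AEMeasurable (fun ω => ∑ j, K₁ (x - Y j ω)) P :=
        Finset.aemeasurable_fun_sum _ fun j _ => hm1.comp_aemeasurable (hYm j)
      fun_prop
  have hjoint : AEMeasurable (fun z : Ω × ℝ => ENNReal.ofReal (|z.2| ^ (p - 1) *
      |prelimEstimator k με h (fun i => Y i z.1) z.2 - cdf M z.2|)) (P.prod volume) := by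
    have h1 : AEMeasurable (fun z : Ω × ℝ => ∑ j, K (z.2 - Y j z.1)) (P.prod volume) :=
      Finset.aemeasurable_fun_sum _ fun j _ => hKm.comp_aemeasurable
        (measurable_snd.aemeasurable.sub (hY j).aemeasurable.comp_fst)
    have h2 : Measurable fun z : Ω × ℝ => cdf M z.2 := (monotone_cdf M).measurable.comp measurable_snd
    simp only [hest]
    have h3 := ((h1.const_mul (1 / (n : ℝ))).sub h2.aemeasurable).abs
    exact ((show Measurable fun z : Ω × ℝ => |z.2| ^ (p - 1) by fun_prop).aemeasurable.mul
      h3).ennreal_ofReal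
  simp only [weightedDist]
  rw [lintegral_lintegral_swap hjoint]
  calc _ ≤ ∫⁻ x, (N * (ENNReal.ofReal (|x| ^ (p - 1)) * (∫⁻ y, ENNReal.ofReal ((K₁ (x - y) -
          if x < 0 then 0 else ∫ u, density (lowSymbol k r h) u) ^ 2) ∂ν) ^ (1 / 2 : ℝ)) +
        N * (ENNReal.ofReal (|x| ^ (p - 1)) *
          (∫⁻ y, ENNReal.ofReal ((K₂ (x - y) - 0) ^ 2) ∂ν) ^ (1 / 2 : ℝ))) := by
        refine lintegral_mono fun x => ?_
        simp only [ENNReal.ofReal_mul (show 0 ≤ |x| ^ (p - 1) by positivity)]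
        rw [lintegral_const_mul' _ _ ENNReal.ofReal_ne_top]
        refine (mul_le_mul_right (hpt x) _).trans (le_of_eq ?_)
        ring
    _ = N * (∫⁻ x, ENNReal.ofReal (|x| ^ (p - 1)) * (∫⁻ y, ENNReal.ofReal ((K₁ (x - y) -
          if x < 0 then 0 else ∫ u, density (lowSymbol k r h) u) ^ 2) ∂ν) ^ (1 / 2 : ℝ)) +
        N * ∫⁻ x, ENNReal.ofReal (|x| ^ (p - 1)) *
          (∫⁻ y, ENNReal.ofReal ((K₂ (x - y) - 0) ^ 2) ∂ν) ^ (1 / 2 : ℝ) := by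
        rw [lintegral_add_right, lintegral_const_mul' _ _ ENNReal.ofReal_ne_top,
          lintegral_const_mul' _ _ ENNReal.ofReal_ne_top]
        have h4 : Measurable fun x => ∫⁻ y, ENNReal.ofReal ((K₂ (x - y) - 0) ^ 2) ∂ν := by
          have := hK₂c.measurable
          refine Measurable.lintegral_prod_right'
            (f := fun z : ℝ × ℝ => ENNReal.ofReal ((K₂ (z.1 - z.2) - 0) ^ 2)) ?_
          fun_prop
        fun_prop
    _ ≤ N * (C₁ * (termA1 p r ν + termA2 p r)) + N * (C₂ * (termA3 p r ν h + termA4 p r h)) := by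
        gcongr
        · exact hC₁ h r ν hh hh1 hr inferInstance
        · exact hC₂ h r ν hh hh1 hr inferInstance
    _ ≤ N * ((C₁ + C₂) * (termA1 p r ν + termA2 p r)) +
        N * ((C₁ + C₂) * (termA3 p r ν h + termA4 p r h)) := by
        gcongr
        · exact le_self_add
        · exact le_add_self
    _ = _ := by push_cast; ring

/-! ### Near-minimality and assembly of the bound -/

lemma weightedDist_triangle (p : ℝ) {F G H : ℝ → ℝ} (hF : Measurable F) (hG : Measurable G) :
    weightedDist p G H ≤ weightedDist p F G + weightedDist p F H := by
  rw [weightedDist, weightedDist, weightedDist, ← lintegral_add_left (by fun_prop)]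
  refine lintegral_mono fun x => ?_
  rw [← ENNReal.ofReal_add (by positivity) (by positivity), ← mul_add]
  apply ENNReal.ofReal_le_ofReal
  gcongr
  rw [abs_sub_comm (F x) (G x)]
  exact abs_sub_le _ _ _

end WassersteinDeconvolution

open WassersteinDeconvolution in
theorem proposition1 (p : ℝ) (hp : 1 ≤ p) (k : ℝ → ℝ) (hk : IsKernel p k) :
    ∃ C : ℝ≥0, ∀ (n : ℕ) (_ : 1 ≤ n) (h : ℝ) (_ : 0 < h) (_ : h ≤ 1)
      (ρ : ℝ) (_ : 0 ≤ ρ) (_ : ρ ≤ (n : ℝ) ^ (-(1 / 2) : ℝ))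
      (μ με : Measure ℝ) [IsProbabilityMeasure μ] [IsProbabilityMeasure με]
      (_ : ∀ t, charFun με t ≠ 0)
      (_ : ContDiff ℝ (leastGt (p + 1 / 2) : ℕ) (recipChar με))
      {Ω : Type*} [MeasurableSpace Ω] (P : Measure Ω) [IsProbabilityMeasure P]
      (X ε : Fin n → Ω → ℝ)
      (_ : ∀ i, HasLaw (X i) μ P) (_ : ∀ i, HasLaw (ε i) με P)
      (_ : iIndepFun X P) (_ : iIndepFun ε P)
      (_ : IndepFun (fun ω i => X i ω) (fun ω i => ε i ω) P)
      (μn : Ω → ProbabilityMeasure ℝ)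
      (_ : ∀ ω, IsIsotoneApprox p ρ
        (prelimEstimator k με h (fun i => X i ω + ε i ω)) (μn ω)),
      (∫⁻ ω, wasserstein p (μn ω) μ ^ p ∂P) ≤
        ENNReal.ofReal ((n : ℝ) ^ (-(1 / 2) : ℝ))
        + ENNReal.ofReal (h ^ p * 2 ^ (p - 1)) * (∫⁻ x, ENNReal.ofReal (|x| ^ p * k x))
        + C * ENNReal.ofReal ((n : ℝ) ^ (-(1 / 2) : ℝ)) *
          (termA1 p (recipChar με) (Measure.conv μ με) + termA2 p (recipChar με)
            + termA3 p (recipChar με) (Measure.conv μ με) h + termA4 p (recipChar με) h) := by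
  obtain ⟨C, hC⟩ := exists_lintegral_weightedDist_le hp hk
  -- The factors come from gluing and from the quantile coupling. In `2 * C + 1`, the `2` is the
  -- triangle inequality through `F̂_n` and the `1` pays for `ρ`.
  refine ⟨Real.toNNReal (2 ^ (p - 1)) * Real.toNNReal (p * 2 ^ (p - 1)) * (2 * C + 1), ?_⟩
  intro n hn h hh hh1 ρ hρ0 hρ μ με _ _ hne hr Ω _ P _ X ε hX hε iX iε hXε μn hμn
  have hY : ∀ i, HasLaw (fun ω => X i ω + ε i ω) (Measure.conv μ με) P := fun i =>
    ⟨(hX i).aemeasurable.add (hε i).aemeasurable, by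
      have hind : IndepFun (X i) (ε i) P :=
        hXε.comp (measurable_pi_apply i) (measurable_pi_apply i)
      have := hind.map_add_eq_map_conv_map₀ (hX i).aemeasurable (hε i).aemeasurable
      rw [(hX i).map_eq, (hε i).map_eq] at this
      exact this⟩
  have hi : iIndepFun (fun i ω => X i ω + ε i ω) P :=
    iIndepFun_add (fun i => (hX i).aemeasurable) (fun i => (hε i).aemeasurable) iX iε hXε
  have hD := hC n hn h hh hh1 μ με hne hr P (fun i ω => X i ω + ε i ω) hY hi
  have hζ := isProbabilityMeasure_kernelLaw hk h
  set M := Measure.conv μ (kernelLaw k h) with hM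
  set c : ℝ≥0∞ := ENNReal.ofReal (2 ^ (p - 1)) with hc
  set d : ℝ≥0∞ := ENNReal.ofReal (p * 2 ^ (p - 1)) with hd
  set N : ℝ≥0∞ := ENNReal.ofReal ((n : ℝ) ^ (-(1 / 2) : ℝ)) with hN
  set A := termA1 p (recipChar με) (Measure.conv μ με) + termA2 p (recipChar με)
    + termA3 p (recipChar με) (Measure.conv μ με) h + termA4 p (recipChar με) h with hA
  have hA1 : 1 ≤ A := by
    have h1 : 1 ≤ termA2 p (recipChar με) := one_le_supDeriv_recipChar με _
    exact h1.trans (le_add_self.trans (le_self_add.trans le_self_add))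
  have hr1 : ContDiff ℝ 1 (recipChar με) := hr.of_le (by
    rw [leastGt]; exact_mod_cast Nat.succ_le_succ (Nat.zero_le _))
  have hsd := contDiff_symbol hp hk hr1 h
  have hsc := hasCompactSupport_symbol hk (recipChar με) hh
  have hKm : Measurable (primitive (density (symbol k (recipChar με) h))) := measurable_primitive
    (continuous_density (hsd.continuous.integrable_of_hasCompactSupport hsc))
  have hFm : ∀ y : Fin n → ℝ, Measurable (prelimEstimator k με h y) := by
    intro y
    have : prelimEstimator k με h y = fun t => 1 / (n : ℝ) *
        ∑ j, primitive (density (symbol k (recipChar με) h)) (t - y j) :=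
      funext fun t => prelimEstimator_eq k με hh (integrable_density hsd hsc) y t
    rw [this]
    fun_prop
  set D : Ω → ℝ≥0∞ := fun ω =>
    weightedDist p (prelimEstimator k με h (fun i => X i ω + ε i ω)) (cdf M)
  have hpt : ∀ ω, wasserstein p (μn ω) μ ^ p ≤
      c * (d * (2 * D ω + N) + ∫⁻ z, ENNReal.ofReal (|z| ^ p) ∂(kernelLaw k h)) := by
    intro ω
    refine (wasserstein_rpow_le_weightedDist_conv hp (μn ω : Measure ℝ) μ (kernelLaw k h)).trans ?_
    gcongr
    refine (weightedDist_triangle p (hFm fun i => X i ω + ε i ω)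
      (monotone_cdf (μn ω : Measure ℝ)).measurable).trans ?_
    -- The competitor is the smoothed law, a genuine probability measure because `k ≥ 0`, so the
    -- isotone step at most doubles its distance to `F̂_n`, up to `ρ`.
    have h1 := hμn ω ⟨M, inferInstance⟩
    calc _ ≤ (D ω + ENNReal.ofReal ρ) + D ω := by gcongr; exact h1
      _ ≤ (D ω + N) + D ω := by gcongr; exact ENNReal.ofReal_le_ofReal hρ
      _ = 2 * D ω + N := by ring
  calc ∫⁻ ω, wasserstein p (μn ω) μ ^ p ∂P
      ≤ ∫⁻ ω, c * (d * (2 * D ω + N) +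
          ∫⁻ z, ENNReal.ofReal (|z| ^ p) ∂(kernelLaw k h)) ∂P := lintegral_mono hpt
    _ = c * (d * (2 * (∫⁻ ω, D ω ∂P) + N) +
          ∫⁻ z, ENNReal.ofReal (|z| ^ p) ∂(kernelLaw k h)) := by
        rw [lintegral_const_mul' _ _ ENNReal.ofReal_ne_top, lintegral_add_right _ measurable_const,
          lintegral_const_mul' _ _ ENNReal.ofReal_ne_top, lintegral_add_right _ measurable_const,
          lintegral_const_mul' _ _ (by norm_num)]
        simp only [lintegral_const, measure_univ, mul_one, hc, hd]
    _ ≤ c * (d * (2 * (C * N * A) + N * A) +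
          ENNReal.ofReal (h ^ p) * ∫⁻ x, ENNReal.ofReal (|x| ^ p * k x)) := by
        rw [lintegral_rpow_kernelLaw hk hh]
        gcongr
        exact le_mul_of_one_le_right zero_le hA1
    _ = ENNReal.ofReal (h ^ p * 2 ^ (p - 1)) * (∫⁻ x, ENNReal.ofReal (|x| ^ p * k x)) +
          c * d * (2 * C + 1) * N * A := by
        rw [ENNReal.ofReal_mul (by positivity), ← hc]
        ring
    -- The separate term `n^(-1/2)` is slack at this point, `ρ` having been absorbed through `A ≥
    -- 1`.
    _ ≤ _ := by
        push_cast
        exact add_le_add le_add_self le_rfl
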